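/- Let $G$ be a finite simple graph. For a graph $H$ and an integer $i\ge 1$, let $c_i(H)$ denote the number of connected components of $H$ with exactly $i$ vertices; for $X\subseteq V(G)$, let $G-X$ denote the subgraph of $G$ induced by $V(G)\setminus X$; and let $P_n$ denote the path on $n$ vertices. If $$c_1(G-X)+\tfrac{2}{3}\,c_3(G-X)\le \tfrac{4}{3}|X|+\tfrac{1}{3}\qquad\text{for every } X\subseteq V(G),$$ then $G$ has a $\{P_2,P_5\}$-factor, i.e. a spanning subgraph each of whose connected components is isomorphic to $P_2$ or $P_5$. -/

import Mathlib

/-- `G.numComponentsOfOrder i` is the number of connected components of `G` with exactly `i`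
vertices. -/
noncomputable def SimpleGraph.numComponentsOfOrder {V : Type*} (G : SimpleGraph V) (i : ℕ) : ℕ :=
  {C : G.ConnectedComponent | C.supp.ncard = i}.ncard

/-- `F` is a `{P₂, P₅}`-factor of `G`: a subgraph of `G` on the same vertex set (a spanning
subgraph), each of whose components is isomorphic to the path on 2 or the path on 5 vertices. -/
def SimpleGraph.IsP2P5Factor {V : Type*} (G F : SimpleGraph V) : Prop :=
  F ≤ G ∧ ∀ C : F.ConnectedComponent,
    Nonempty (C.toSimpleGraph ≃g SimpleGraph.pathGraph 2) ∨
      Nonempty (C.toSimpleGraph ≃g SimpleGraph.pathGraph 5)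

/-! Choose a vertex set Z maximizing the number of odd components of G[Z] plus |Z|, with |Z| least,
and let A be its complement: a Tutte barrier of largest deficiency. Extremality makes every
component of G[Z] odd and factor-critical (`factorCritical_of_extremal`), and Hall's theorem matches
A into these components (`exists_injective_of_extremal`). A factor-critical component of order at
least five has a factor of its own (`FactorCritical.tiled`), so only isolated vertices and triangles
need help from A. Since a component minus any vertex has a perfect matching, it is enough to tile
the bipartite graph between A and the contracted components by a few kinds of pieces, each of which
expands to a P₅ or P₂ plus matching edges, or to a single large component (`tiled_of_barrierPiece`).

Give an isolated vertex demand 3, a triangle demand 2, any other component demand 0. Three times the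
hypothesis is then Hall's condition for a transport in which each vertex of A supplies at most 4
units and at most one unit of demand stays unmet (`exists_weights_of_hall`). Cancelling cycles makes
the support a forest, which is rooted so that the component with the unmet unit is a root. An
induction from the leaves upwards builds the tiling (`componentState_of_children`,
`barrierState_of_children`): a component whose subtree cannot be tiled takes at least 2 of the 4
units of its parent, so few conflicts meet at one vertex. This may leave vertices of A uncovered;
the matching of A into the components absorbs them (`Tiled.insert_inl`). -/

open Set

/-! ### Disjoint unions of pieces -/

/-- `Tiled Piece S` says that `S` is a finite disjoint union of sets satisfying `Piece`. -/
inductive Tiled {α : Type*} (Piece : Set α → Prop) : Set α → Prop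
  | empty : Tiled Piece ∅
  | union {P S : Set α} : Piece P → Tiled Piece S → Disjoint P S → Tiled Piece (P ∪ S)

namespace Tiled

variable {α β ι : Type*} {Piece : Set α → Prop} {S T P : Set α}

theorem of_piece (h : Piece P) : Tiled Piece P := by
  simpa using Tiled.union h Tiled.empty (disjoint_empty P)

theorem congr (hS : Tiled Piece S) (h : S = T) : Tiled Piece T := h ▸ hS

theorem disjUnion (hS : Tiled Piece S) (hT : Tiled Piece T) (hd : Disjoint S T) :
    Tiled Piece (S ∪ T) := by
  induction hS with
  | empty => simpa using hT
  | union hP _ hPS ih =>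
    rw [disjoint_union_left] at hd
    rw [union_assoc]
    exact .union hP (ih hd.2) (disjoint_union_right.2 ⟨hPS, hd.1⟩)

/-- Tilings of two disjoint sets combine to a tiling of any set that is their union. -/
theorem of_union_eq (hS : Tiled Piece S) (hT : Tiled Piece T) (hd : Disjoint S T)
    {U : Set α} (hU : U = S ∪ T) : Tiled Piece U :=
  hU ▸ hS.disjUnion hT hd

theorem biUnion {I : Set ι} (hI : I.Finite) {f : ι → Set α}
    (hd : I.PairwiseDisjoint f) (h : ∀ i ∈ I, Tiled Piece (f i)) :
    Tiled Piece (⋃ i ∈ I, f i) := by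
  induction I, hI using Set.Finite.induction_on with
  | empty => simpa using Tiled.empty
  | @insert a J haJ _ ih =>
    rw [biUnion_insert]
    refine (h a (mem_insert _ _)).disjUnion
      (ih (hd.subset (subset_insert _ _)) fun i hi => h i (mem_insert_of_mem _ hi)) ?_
    rw [disjoint_iUnion₂_right]
    intro i hi
    exact hd (mem_insert _ _) (mem_insert_of_mem _ hi) (by rintro rfl; exact haJ hi)

theorem exists_piece (hS : Tiled Piece S) {x : α} (hx : x ∈ S) :
    ∃ P T, Piece P ∧ x ∈ P ∧ Tiled Piece T ∧ Disjoint P T ∧ S = P ∪ T := by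
  induction hS with
  | empty => exact hx.elim
  | @union P S hP hS hd ih =>
    rcases hx with hx | hx
    · exact ⟨P, S, hP, hx, hS, hd, rfl⟩
    · obtain ⟨Q, T, hQ, hxQ, hT, hQT, rfl⟩ := ih hx
      rw [disjoint_union_right] at hd
      exact ⟨Q, P ∪ T, hQ, hxQ, .union hP hT hd.2,
        disjoint_union_right.2 ⟨hd.1.symm, hQT⟩, union_left_comm _ _ _⟩

/-- Replace every point of a tiled set by a set, and retile the pieces. -/
theorem blowup {Q : Set β → Prop} {φ : α → Set β} (hφ : Pairwise (Function.onFun Disjoint φ))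
    (h : ∀ P, Piece P → Tiled Q (⋃ x ∈ P, φ x)) (hS : Tiled Piece S) :
    Tiled Q (⋃ x ∈ S, φ x) := by
  induction hS with
  | empty => simpa using Tiled.empty
  | @union P S hP _ hd ih =>
    rw [biUnion_union]
    refine (h _ hP).disjUnion ih ?_
    simp only [disjoint_iUnion_left, disjoint_iUnion_right]
    intro x hx y hy
    exact hφ (by rintro rfl; exact Set.disjoint_left.1 hd hy hx)

end Tiled

/-! ### Path sets, and factors from tilings -/

namespace SimpleGraph

variable {V : Type*} {G : SimpleGraph V}

/-- `P` is the vertex set of a path of `G` on `n` vertices. -/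
def IsPathSet (G : SimpleGraph V) (n : ℕ) (P : Set V) : Prop :=
  ∃ f : Fin n → V, Function.Injective f ∧ range f = P ∧
    ∀ i j, (pathGraph n).Adj i j → G.Adj (f i) (f j)

/-- `P` is the vertex set of a path of `G` on two or five vertices. -/
def IsP2P5Set (G : SimpleGraph V) (P : Set V) : Prop :=
  G.IsPathSet 2 P ∨ G.IsPathSet 5 P

theorem isPathSet_two {x y : V} (h : G.Adj x y) : G.IsPathSet 2 {x, y} := by
  refine ⟨![x, y], ?_, by simp [pair_comm], ?_⟩
  · intro i j
    fin_cases i <;> fin_cases j <;> simp [h.ne, h.ne']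
  · intro i j
    fin_cases i <;> fin_cases j <;> simp [pathGraph_adj, h, h.symm]

theorem isPathSet_five {a b c d e : V} (hab : G.Adj a b) (hbc : G.Adj b c) (hcd : G.Adj c d)
    (hde : G.Adj d e) (hac : a ≠ c) (had : a ≠ d) (hae : a ≠ e) (hbd : b ≠ d) (hbe : b ≠ e)
    (hce : c ≠ e) : G.IsPathSet 5 {a, b, c, d, e} := by
  have h1 := hab.ne
  have h2 := hbc.ne
  have h3 := hcd.ne
  have h4 := hde.ne
  refine ⟨![a, b, c, d, e], ?_, ?_, ?_⟩
  · intro i j hij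
    fin_cases i <;> fin_cases j <;> simp_all [eq_comm]
  · ext x
    simp only [mem_range, Fin.exists_fin_succ, mem_insert_iff, mem_singleton_iff]
    simp [eq_comm]
  · intro i j
    fin_cases i <;> fin_cases j <;>
      simp [pathGraph_adj, hab, hab.symm, hbc, hbc.symm, hcd, hcd.symm, hde, hde.symm]

/-- A tiled set carries a subgraph of `G` in which every vertex lies on a path on two or five
vertices that is a union of components. -/
theorem exists_le_of_tiled (S : Set V) (hS : Tiled G.IsP2P5Set S) :
    ∃ F ≤ G, (∀ x y, F.Adj x y → x ∈ S ∧ y ∈ S) ∧ ∀ x ∈ S, ∃ n, (n = 2 ∨ n = 5) ∧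
      ∃ f : Fin n → V, Function.Injective f ∧ x ∈ range f ∧
        (∀ i j, F.Adj (f i) (f j) ↔ (pathGraph n).Adj i j) ∧
        ∀ i y, F.Adj (f i) y → y ∈ range f := by
  induction hS with
  | empty => exact ⟨⊥, bot_le, by simp, by simp⟩
  | @union P S hP _ hd ih =>
    obtain ⟨F, hFG, hFS, hF⟩ := ih
    have hP' : ∃ n, (n = 2 ∨ n = 5) ∧ G.IsPathSet n P := by
      rcases hP with h | h
      · exact ⟨2, .inl rfl, h⟩
      · exact ⟨5, .inr rfl, h⟩
    obtain ⟨n, hn, f, hf, rfl, hfG⟩ := hP'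
    have hK : ∀ x y, ((pathGraph n).map f).Adj x y →
        ∃ i j, (pathGraph n).Adj i j ∧ f i = x ∧ f j = y :=
      fun x y => (map_adj ⟨f, hf⟩ _ x y).1
    have hKf : ∀ i j, ((pathGraph n).map f).Adj (f i) (f j) ↔ (pathGraph n).Adj i j :=
      fun i j => map_adj_apply (f := ⟨f, hf⟩)
    have hK₁ : ∀ x y, ((pathGraph n).map f).Adj x y → x ∈ range f ∧ y ∈ range f := by
      intro x y h
      obtain ⟨i, j, -, rfl, rfl⟩ := hK x y h
      exact ⟨⟨i, rfl⟩, ⟨j, rfl⟩⟩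
    refine ⟨F ⊔ (pathGraph n).map f, sup_le hFG ?_, ?_, ?_⟩
    · intro x y h
      obtain ⟨i, j, hij, rfl, rfl⟩ := hK x y h
      exact hfG i j hij
    · rintro x y (h | h)
      · exact ⟨.inr (hFS _ _ h).1, .inr (hFS _ _ h).2⟩
      · exact ⟨.inl (hK₁ _ _ h).1, .inl (hK₁ _ _ h).2⟩
    · rintro x (hx | hx)
      · refine ⟨n, hn, f, hf, hx, fun i j => ?_, ?_⟩
        · rw [sup_adj, hKf, or_iff_right]
          exact fun h => Set.disjoint_left.1 hd (mem_range_self i) (hFS _ _ h).1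
        · rintro i y (h | h)
          · exact (Set.disjoint_left.1 hd (mem_range_self i) (hFS _ _ h).1).elim
          · exact (hK₁ _ _ h).2
      · obtain ⟨m, hm, g, hg, hxg, hgF, hgc⟩ := hF x hx
        -- No vertex of a path of order 2 or 5 is isolated, and the edges of `F` stay inside `S`.
        have hgS : ∀ i, g i ∈ S := by
          intro i
          obtain ⟨j, hij⟩ : ∃ j, (pathGraph m).Adj i j := by
            rcases hm with rfl | rfl <;> simp only [pathGraph_adj] <;> revert i <;> decide
          exact (hFS _ _ ((hgF i j).2 hij)).1
        have hgK : ∀ i y, ¬ ((pathGraph n).map f).Adj (g i) y := fun i y h =>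
          Set.disjoint_left.1 hd (hK₁ _ _ h).1 (hgS i)
        refine ⟨m, hm, g, hg, hxg, fun i j => ?_, ?_⟩
        · rw [sup_adj, hgF, or_iff_left (hgK _ _)]
        · rintro i y (h | h)
          · exact hgc i y h
          · exact (hgK _ _ h).elim

/-- The range of each path is connected in `F` and closed under `F`-adjacency, hence is the full
support of a component. -/
theorem exists_isP2P5Factor_of_tiled (hG : Tiled G.IsP2P5Set univ) :
    ∃ F, G.IsP2P5Factor F := by
  obtain ⟨F, hFG, -, hF⟩ := exists_le_of_tiled univ hG
  refine ⟨F, hFG, fun C => ?_⟩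
  induction C using ConnectedComponent.ind with | _ x
  obtain ⟨n, hn, f, hf, ⟨i₀, rfl⟩, hfF, hfc⟩ := hF x (mem_univ x)
  have hsupp : ∀ y, y ∈ (F.connectedComponentMk (f i₀)).supp ↔ y ∈ range f := by
    intro y
    rw [ConnectedComponent.mem_supp_iff, ConnectedComponent.eq]
    constructor
    · intro h
      have key : ∀ a b, F.Walk a b → a ∈ range f → b ∈ range f := by
        intro a b p
        induction p with
        | nil => exact id
        | cons h _ ih =>
          rintro ⟨i, rfl⟩
          exact ih (hfc i _ h)
      exact key _ _ h.symm.some (mem_range_self _)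
    · rintro ⟨i, rfl⟩
      have hp := (pathGraph_preconnected n) i i₀
      exact hp.map ⟨f, fun h => (hfF _ _).2 h⟩
  have e : pathGraph n ≃g (F.connectedComponentMk (f i₀)).toSimpleGraph :=
    { toEquiv := Equiv.ofBijective (fun i => ⟨f i, (hsupp _).2 ⟨i, rfl⟩⟩)
        ⟨fun i j h => hf (congrArg Subtype.val h), fun ⟨y, hy⟩ => by
          obtain ⟨i, rfl⟩ := (hsupp y).1 hy
          exact ⟨i, rfl⟩⟩
      map_rel_iff' := by
        intro i j
        exact hfF i j }
  rcases hn with rfl | rfl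
  · exact .inl ⟨e.symm⟩
  · exact .inr ⟨e.symm⟩

end SimpleGraph

/-! ### Subtrees of a rooted forest -/

section Descendants

variable {α : Type*} (R : α → α → Prop)

/-- The descendants of `v`, including `v`, under the child relation `R`. -/
def descendants (v : α) : Set α := {x | Relation.ReflTransGen R v x}

variable {R} {rank : α → ℕ} {v x y : α}

theorem self_mem_descendants : v ∈ descendants R v := Relation.ReflTransGen.refl

theorem rank_le_of_mem_descendants (hR : ∀ x y, R x y → rank x < rank y)
    (h : x ∈ descendants R v) : rank v ≤ rank x := by
  induction (h : Relation.ReflTransGen R v x) with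
  | refl => exact le_rfl
  | tail _ h ih => exact ih.trans (hR _ _ h).le

theorem notMem_descendants_of_rel (hR : ∀ x y, R x y → rank x < rank y) (h : R v x) :
    v ∉ descendants R x := fun hv =>
  (hR _ _ h).not_ge (rank_le_of_mem_descendants hR hv)

theorem descendants_eq (v : α) :
    descendants R v = insert v (⋃ c ∈ {c | R v c}, descendants R c) := by
  ext x
  simp only [descendants, mem_ofPred_eq, mem_insert_iff, mem_iUnion, exists_prop]
  rw [Relation.ReflTransGen.cases_head_iff]
  tauto

theorem descendants_subset_of_rel (h : R v x) : descendants R x ⊆ descendants R v :=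
  fun _ hy => Relation.ReflTransGen.head h hy

/-- Parents are unique, so the ancestors of a common descendant form a chain, and one of `x`, `y`
would descend from the other. That descent would have to pass through their common parent `v`, whose
rank is too small. -/
theorem disjoint_descendants (hR : ∀ x y, R x y → rank x < rank y)
    (huniq : ∀ x y z, R x z → R y z → x = y) (hx : R v x) (hy : R v y) (hxy : x ≠ y) :
    Disjoint (descendants R x) (descendants R y) := by
  rw [Set.disjoint_left]
  have key : ∀ x y, R v x → R v y → x ≠ y → ¬ Relation.ReflTransGen R x y := by
    intro x y hx hy hxy h
    rcases Relation.ReflTransGen.cases_tail h with h | ⟨w, hxw, hwy⟩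
    · exact hxy h.symm
    · obtain rfl := huniq _ _ _ hwy hy
      exact (hR _ _ hx).not_ge (rank_le_of_mem_descendants hR hxw)
  intro z hxz hyz
  have hxz' : Relation.ReflTransGen (Function.swap R) z x := Relation.ReflTransGen.swap _ _ hxz
  have hyz' : Relation.ReflTransGen (Function.swap R) z y := Relation.ReflTransGen.swap _ _ hyz
  rcases Relation.ReflTransGen.total_of_right_unique
    (r := Function.swap R) (fun a b c hb hc => huniq _ _ _ hb hc) hxz' hyz' with h | h
  · exact key y x hy hx hxy.symm (Relation.ReflTransGen.swap _ _ h)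
  · exact key x y hx hy hxy (Relation.ReflTransGen.swap _ _ h)

/-- The descendants of `v` consist of `v`, the descendants of the children in `J`, and a tiled
rest, if the descendants of all other children can be tiled. -/
theorem Tiled.exists_descendants_eq_union [Finite α] {Piece : Set α → Prop}
    (hR : ∀ x y, R x y → rank x < rank y)
    (huniq : ∀ x y z, R x z → R y z → x = y) {J : Set α} (hJ : ∀ c ∈ J, R v c)
    (h' : ∀ c, R v c → c ∉ J → Tiled Piece (descendants R c)) :
    ∃ X, Tiled Piece X ∧ Disjoint (insert v (⋃ c ∈ J, descendants R c)) X ∧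
      descendants R v = insert v (⋃ c ∈ J, descendants R c) ∪ X := by
  refine ⟨⋃ c ∈ {c | R v c ∧ c ∉ J}, descendants R c, Tiled.biUnion (toFinite _)
      (fun c hc c' hc' hcc => disjoint_descendants hR huniq hc.1 hc'.1 hcc)
      (fun c hc => h' c hc.1 hc.2), ?_, ?_⟩
  · simp only [disjoint_iUnion_right]
    intro c hc
    rw [disjoint_insert_left]
    refine ⟨notMem_descendants_of_rel hR hc.1, ?_⟩
    simp only [disjoint_iUnion_left]
    intro c' hc'
    exact disjoint_descendants hR huniq (hJ _ hc') hc.1 (by rintro rfl; exact hc.2 hc')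
  · rw [descendants_eq v, insert_union]
    congr 1
    ext x
    simp only [mem_iUnion, mem_ofPred_eq, mem_union, exists_prop]
    constructor
    · rintro ⟨c, hc, hx⟩
      by_cases hcJ : c ∈ J
      · exact .inl ⟨c, hcJ, hx⟩
      · exact .inr ⟨c, ⟨hc, hcJ⟩, hx⟩
    · rintro (⟨c, hc, hx⟩ | ⟨c, hc, hx⟩)
      · exact ⟨c, hJ c hc, hx⟩
      · exact ⟨c, hc.1, hx⟩

/-- To tile the descendants of `v` together with an outside set `E`, tile `E`, `v` and the
descendants of some children in a joint way, and the descendants of all other children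
separately. -/
theorem Tiled.descendants_union [Finite α] {Piece : Set α → Prop}
    (hR : ∀ x y, R x y → rank x < rank y)
    (huniq : ∀ x y z, R x z → R y z → x = y) {J : Set α} (hJ : ∀ c ∈ J, R v c) {E : Set α}
    (hE : Disjoint E (descendants R v))
    (h : Tiled Piece (E ∪ insert v (⋃ c ∈ J, descendants R c)))
    (h' : ∀ c, R v c → c ∉ J → Tiled Piece (descendants R c)) :
    Tiled Piece (E ∪ descendants R v) := by
  obtain ⟨X, hX, hd, heq⟩ := Tiled.exists_descendants_eq_union hR huniq hJ h'
  rw [heq] at hE ⊢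
  exact h.of_union_eq hX
    (disjoint_union_left.2 ⟨(disjoint_union_right.1 hE).2, hd⟩) (union_assoc _ _ _).symm

theorem Tiled.descendants_diff_self [Finite α] {Piece : Set α → Prop}
    (hR : ∀ x y, R x y → rank x < rank y)
    (huniq : ∀ x y z, R x z → R y z → x = y)
    (h : ∀ c, R v c → Tiled Piece (descendants R c)) :
    Tiled Piece (descendants R v \ {v}) := by
  have : descendants R v \ {v} = ⋃ c ∈ {c | R v c}, descendants R c := by
    rw [descendants_eq v, insert_sdiff_self_of_notMem]
    simp only [mem_iUnion, not_exists]
    exact fun c hc => notMem_descendants_of_rel hR hc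
  rw [this]
  exact Tiled.biUnion (toFinite _)
      (fun c hc c' hc' hcc => disjoint_descendants hR huniq hc hc' hcc) h

/-- If the descendants of every root can be tiled, so can everything. -/
theorem Tiled.univ_of_roots [Finite α] {Piece : Set α → Prop}
    (hR : ∀ x y, R x y → rank x < rank y)
    (huniq : ∀ x y z, R x z → R y z → x = y)
    (h : ∀ v, (∀ p, ¬ R p v) → Tiled Piece (descendants R v)) :
    Tiled Piece univ := by
  have : (univ : Set α) = ⋃ v ∈ {v | ∀ p, ¬ R p v}, descendants R v := by
    refine (eq_univ_of_forall fun x => ?_).symm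
    induction hn : rank x using Nat.strong_induction_on generalizing x with
    | _ n ih =>
      by_cases hx : ∀ p, ¬ R p x
      · exact mem_biUnion hx self_mem_descendants
      · push Not at hx
        obtain ⟨p, hp⟩ := hx
        obtain ⟨v, hv, hpv⟩ := mem_iUnion₂.1 (ih _ (hn ▸ hR _ _ hp) p rfl)
        exact mem_biUnion hv (Relation.ReflTransGen.tail hpv hp)
  rw [this]
  refine Tiled.biUnion (toFinite _) (fun v hv w hw hvw => ?_) h
  rw [Function.onFun, Set.disjoint_left]
  have key : ∀ v w, (∀ p, ¬ R p w) → v ≠ w → ¬ Relation.ReflTransGen R v w := by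
    intro v w hw hvw h
    rcases Relation.ReflTransGen.cases_tail h with h | ⟨p, _, hp⟩
    · exact hvw h.symm
    · exact hw p hp
  intro z hvz hwz
  have hvz' : Relation.ReflTransGen (Function.swap R) z v := Relation.ReflTransGen.swap _ _ hvz
  have hwz' : Relation.ReflTransGen (Function.swap R) z w := Relation.ReflTransGen.swap _ _ hwz
  rcases Relation.ReflTransGen.total_of_right_unique
    (r := Function.swap R) (fun a b c hb hc => huniq _ _ _ hb hc) hvz' hwz' with h | h
  · exact key w v hv hvw.symm (Relation.ReflTransGen.swap _ _ h)
  · exact key v w hw hvw (Relation.ReflTransGen.swap _ _ h)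

end Descendants

/-! ### Pieces in the contracted bipartite graph -/

section Pieces

variable {A D : Type*} (r : A → D → Prop) (dem : D → ℕ)

/-- The pieces from which a factor is assembled in the bipartite graph between a barrier `A` and
the components `D` of its complement. The demand `dem d` is `3` for a component of order one, `2`
for a triangle, and `0` for a larger component. -/
inductive BarrierPiece : Set (A ⊕ D) → Prop
  | single {d : D} : dem d = 0 → BarrierPiece {.inr d}
  | edge {a : A} {d : D} : r a d → BarrierPiece {.inl a, .inr d}
  | cherry {a : A} {d d' : D} : dem d = 2 → r a d → r a d' → d ≠ d' →
      BarrierPiece {.inr d, .inl a, .inr d'}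
  | path {a a' : A} {d₁ d d₂ : D} : dem d = 3 → r a d₁ → r a d → r a' d → r a' d₂ →
      a ≠ a' → d₁ ≠ d → d₁ ≠ d₂ → d ≠ d₂ →
      BarrierPiece {.inr d₁, .inl a, .inr d, .inl a', .inr d₂}

/-- A barrier piece, or a single vertex of the barrier. -/
def WeakBarrierPiece (P : Set (A ⊕ D)) : Prop :=
  BarrierPiece r dem P ∨ ∃ a, P = {.inl a}

variable {r dem}

theorem Tiled.insert_edge {S : Set (A ⊕ D)} {a : A} {d : D} (h : r a d)
    (hS : Tiled (BarrierPiece r dem) S) (ha : .inl a ∉ S) (hd : .inr d ∉ S) :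
    Tiled (BarrierPiece r dem) (insert (.inl a) (insert (.inr d) S)) := by
  simpa [insert_union] using Tiled.union (.edge h) hS (by simp [ha, hd])

/-- An augmentation step: pair `a₀` with `M a₀` and break up the piece that contained `M a₀`. A
single, cherry or path has one component more than it has barrier vertices, and what is left of it
splits into edges. An edge instead releases its barrier vertex, which is reinserted into the smaller
tiling `T`; injectivity of `M` keeps the required partners inside `T`. -/
theorem Tiled.insert_inl [Finite A] [Finite D] {M : A → D} (hM : Function.Injective M)
    (hr : ∀ a, r a (M a)) {S : Set (A ⊕ D)} {a₀ : A} (hS : Tiled (BarrierPiece r dem) S)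
    (ha₀ : .inl a₀ ∉ S) (hMS : ∀ a, .inl a ∈ S ∨ a = a₀ → .inr (M a) ∈ S) :
    Tiled (BarrierPiece r dem) (insert (.inl a₀) S) := by
  induction hn : S.ncard using Nat.strong_induction_on generalizing S a₀ with
  | _ n ih =>
  obtain ⟨P, T, hP, hd, hT, hPT, rfl⟩ := hS.exists_piece (hMS a₀ (.inr rfl))
  have hr₀ := hr a₀
  cases hP with
  | single h =>
    simp only [mem_singleton_iff, Sum.inr.injEq] at hd
    subst hd
    have h1 := Tiled.insert_edge hr₀ hT (by grind) (by grind)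
    exact h1.congr (by ext x; simp only [mem_insert_iff, mem_union, mem_singleton_iff])
  | @edge a d h =>
    simp only [mem_insert_iff, mem_singleton_iff, Sum.inr.injEq, reduceCtorEq, false_or] at hd
    subst hd
    simp only [disjoint_insert_left, disjoint_singleton_left] at hPT
    simp only [mem_union, mem_insert_iff, mem_singleton_iff, Sum.inl.injEq, reduceCtorEq,
      or_false, not_or] at ha₀
    have h1 := ih T.ncard (by
      rw [← hn]
      apply ncard_lt_ncard _ (toFinite _)
      refine ⟨subset_union_right, fun h => hPT.1 (h (.inl (by simp)))⟩) hT hPT.1 (by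
        intro b hb
        have := hMS b (.inl (by rcases hb with hb | rfl <;> simp [*]))
        simp only [mem_union, mem_insert_iff, mem_singleton_iff, reduceCtorEq, false_or,
          Sum.inr.injEq] at this
        rcases this with h | h
        · obtain rfl := hM h
          rcases hb with hb | rfl
          · exact (ha₀.2 hb).elim
          · exact (ha₀.1 rfl).elim
        · exact h) rfl
    have h2 := Tiled.insert_edge hr₀ h1 (by grind) (by grind)
    exact h2.congr (by ext x; simp only [mem_insert_iff, mem_union, mem_singleton_iff]; tauto)
  | @cherry a d d' hdem h h' hdd =>
    clear ih hMS hn hS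
    simp only [mem_union, mem_insert_iff, mem_singleton_iff, Sum.inl.injEq, reduceCtorEq,
      or_false, false_or, not_or, Sum.inr.injEq, disjoint_insert_left,
      disjoint_singleton_left] at *
    rcases hd with rfl | rfl
    · have h2 := Tiled.insert_edge hr₀
        (Tiled.insert_edge h' hT (by grind) (by grind)) (by grind) (by grind)
      exact h2.congr (by ext x; simp only [mem_insert_iff, mem_union, mem_singleton_iff]; tauto)
    · have h2 := Tiled.insert_edge hr₀
        (Tiled.insert_edge h hT (by grind) (by grind)) (by grind) (by grind)
      exact h2.congr (by ext x; simp only [mem_insert_iff, mem_union, mem_singleton_iff]; tauto)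
  | @path a a' d₁ d d₂ hdem h₁ h h' h₂ haa n₁ n₂ n₃ =>
    clear ih hMS hn hS
    simp only [mem_union, mem_insert_iff, mem_singleton_iff, Sum.inl.injEq, reduceCtorEq,
      or_false, false_or, not_or, Sum.inr.injEq, disjoint_insert_left,
      disjoint_singleton_left] at *
    rcases hd with rfl | rfl | rfl
    · have h2 := Tiled.insert_edge hr₀
        (Tiled.insert_edge h
          (Tiled.insert_edge h₂ hT (by grind) (by grind)) (by grind) (by grind)) (by grind) (by grind)
      exact h2.congr (by ext x; simp only [mem_insert_iff, mem_union, mem_singleton_iff]; tauto)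
    · have h2 := Tiled.insert_edge hr₀
        (Tiled.insert_edge h₁
          (Tiled.insert_edge h₂ hT (by grind) (by grind)) (by grind) (by grind))
          (by grind) (by grind)
      exact h2.congr (by ext x; simp only [mem_insert_iff, mem_union, mem_singleton_iff]; tauto)
    · have h2 := Tiled.insert_edge hr₀
        (Tiled.insert_edge h₁
          (Tiled.insert_edge h' hT (by grind) (by grind)) (by grind) (by grind))
          (by grind) (by grind)
      exact h2.congr (by ext x; simp only [mem_insert_iff, mem_union, mem_singleton_iff]; tauto)

/-- If the barrier can be matched into the components, then a tiling by weak pieces can be turned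
into a tiling by pieces. -/
theorem Tiled.barrierPiece_of_weak [Finite A] [Finite D] {M : A → D} (hM : Function.Injective M)
    (hr : ∀ a, r a (M a)) (h : Tiled (WeakBarrierPiece r dem) univ) :
    Tiled (BarrierPiece r dem) univ := by
  -- Discard the lone barrier vertices. All components stay covered, so only barrier vertices are
  -- missing, and they are reinserted one at a time.
  have key : ∀ S, Tiled (WeakBarrierPiece r dem) S →
      ∃ T ⊆ S, Tiled (BarrierPiece r dem) T ∧ ∀ d, .inr d ∈ S → .inr d ∈ T := by
    intro S hS
    induction hS with
    | empty => exact ⟨∅, subset_rfl, .empty, by simp⟩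
    | @union P S hP _ hd ih =>
      obtain ⟨T, hTS, hT, hdT⟩ := ih
      rcases hP with hP | ⟨a, rfl⟩
      · exact ⟨P ∪ T, union_subset_union_right _ hTS, .union hP hT (hd.mono_right hTS),
          fun d hd => hd.imp_right (hdT d)⟩
      · exact ⟨T, hTS.trans subset_union_right, hT, by simpa using hdT⟩
  obtain ⟨T, -, hT, hdT⟩ := key _ h
  replace hdT : ∀ d, .inr d ∈ T := fun d => hdT d (mem_univ _)
  induction hn : Tᶜ.ncard generalizing T with
  | zero =>
    rw [ncard_eq_zero, compl_empty_iff] at hn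
    exact hn ▸ hT
  | succ n ih =>
    obtain ⟨x, hx⟩ := nonempty_of_ncard_ne_zero (by lia : Tᶜ.ncard ≠ 0)
    rcases x with a | d
    · refine ih _ (hT.insert_inl hM hr hx fun b _ => hdT _) (fun d => .inr (hdT d)) ?_
      rw [← union_singleton, compl_union, ← sdiff_eq, ncard_sdiff_singleton_of_mem hx, hn]
      rfl
    · exact (hx (hdT d)).elim

end Pieces

/-! ### Bottom-up tiling of a weighted forest -/

section WeightedForest

variable {A D : Type*}

/-- The child relation of a forest with edge weights `g`, rooted according to `rank`. -/
inductive ForestChild (g : A → D → ℕ) (rank : A ⊕ D → ℕ) : A ⊕ D → A ⊕ D → Prop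
  | down {a : A} {d : D} : 0 < g a d → rank (.inl a) < rank (.inr d) →
      ForestChild g rank (.inl a) (.inr d)
  | up {a : A} {d : D} : 0 < g a d → rank (.inr d) < rank (.inl a) →
      ForestChild g rank (.inr d) (.inl a)

variable {g : A → D → ℕ} {rank : A ⊕ D → ℕ} {r : A → D → Prop} {dem : D → ℕ}

theorem ForestChild.rank_lt (x y : A ⊕ D) (h : ForestChild g rank x y) : rank x < rank y := by
  cases h <;> assumption

theorem Tiled.weak_union {P S : Set (A ⊕ D)} (hP : BarrierPiece r dem P)
    (hS : Tiled (WeakBarrierPiece r dem) S) (hd : Disjoint P S) :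
    Tiled (WeakBarrierPiece r dem) (P ∪ S) := .union (.inl hP) hS hd

variable [Fintype A]

open Classical in
/-- The total weight of the edges from `d` to its children. -/
noncomputable def childWeight (g : A → D → ℕ) (rank : A ⊕ D → ℕ) (d : D) : ℕ :=
  ∑ a with ForestChild g rank (.inr d) (.inl a), g a d

variable (g rank r dem) in
/-- The possible states of the subtree below `d`: either it can be tiled, or it can be tiled
together with any path of length two starting at `d` and leaving the subtree, or it is a
leaf. -/
structure ComponentState (d : D) : Prop where
  diff_self : Tiled (WeakBarrierPiece r dem) (descendants (ForestChild g rank) (.inr d) \ {.inr d})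
  cases : Tiled (WeakBarrierPiece r dem) (descendants (ForestChild g rank) (.inr d)) ∨
    (childWeight g rank d + 2 ≤ dem d ∧ ∀ a d', .inl a ∉ descendants (ForestChild g rank) (.inr d) →
      .inr d' ∉ descendants (ForestChild g rank) (.inr d) → r a d → r a d' →
      Tiled (WeakBarrierPiece r dem)
        (insert (.inl a) (insert (.inr d') (descendants (ForestChild g rank) (.inr d))))) ∨
    (dem d = 3 ∧ childWeight g rank d = 0)

variable (g rank r dem) in
/-- The possible states of the subtree below the barrier vertex `a`: it can be tiled, and its
parent can be added to the tiling, or used as the middle of a path. -/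
structure BarrierState (a : A) : Prop where
  tiled : Tiled (WeakBarrierPiece r dem) (descendants (ForestChild g rank) (.inl a))
  parent : ∀ d, ForestChild g rank (.inr d) (.inl a) →
    Tiled (WeakBarrierPiece r dem) (insert (.inr d) (descendants (ForestChild g rank) (.inl a))) ∨
    (g a d ≤ 1 ∧ ∃ u T, dem u = 3 ∧ r a u ∧
      Tiled (WeakBarrierPiece r dem) T ∧ .inl a ∉ T ∧ .inr u ∉ T ∧
      descendants (ForestChild g rank) (.inl a) = insert (.inl a) (insert (.inr u) T))

/-- If some child subtree absorbs `d`, the subtree of `d` is tiled. Otherwise each child `a` carries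
weight at most 1 and offers a spare isolated vertex `u`. For demand 2, one child gives the cherry
`d, a, u`; without children `d` can start a cherry leaving the subtree. For demand 3, two children
give the path `u, a, d, a', u'`; one child gives a path `u, a, d` to be continued outside, with at
least 2 units of demand left for the parent; with no child `d` is a leaf. -/
theorem componentState_of_children [Fintype D]
    (huniq : ∀ x y z, ForestChild g rank x z → ForestChild g rank y z → x = y)
    (hdem : ∀ d, dem d = 0 ∨ dem d = 2 ∨ dem d = 3) (hr : ∀ a d, 0 < g a d → r a d) (d : D)
    (ih : ∀ a, ForestChild g rank (.inr d) (.inl a) → BarrierState g rank r dem a) :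
    ComponentState g rank r dem d := by
  classical
  set R := ForestChild g rank with hR
  have hlt : ∀ x y, R x y → rank x < rank y := ForestChild.rank_lt
  have hch : ∀ c, R (.inr d) c → Tiled (WeakBarrierPiece r dem) (descendants R c) := by
    rintro c hc
    cases hc with | up h1 h2 => exact (ih _ (.up h1 h2)).tiled
  have hrR : ∀ a, R (.inr d) (.inl a) → r a d := by
    intro a ha
    cases ha with | up h1 h2 => exact hr _ _ h1
  refine ⟨Tiled.descendants_diff_self hlt huniq hch, ?_⟩
  have retile : ∀ (J : Set (A ⊕ D)) (E : Set (A ⊕ D)), (∀ c ∈ J, R (.inr d) c) →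
      Disjoint E (descendants R (.inr d)) →
      Tiled (WeakBarrierPiece r dem) (E ∪ insert (.inr d) (⋃ c ∈ J, descendants R c)) →
      Tiled (WeakBarrierPiece r dem) (E ∪ descendants R (.inr d)) := fun J E hJ hE h =>
    Tiled.descendants_union hlt huniq hJ hE h fun c hc _ => hch c hc
  by_cases hgood : ∃ a, R (.inr d) (.inl a) ∧
      Tiled (WeakBarrierPiece r dem) (insert (.inr d) (descendants R (.inl a)))
  · obtain ⟨a, ha, hT⟩ := hgood
    left
    simpa using retile {.inl a} ∅ (by simpa using ha) (by simp) (by simpa using hT)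
  push Not at hgood
  have hbad : ∀ a, R (.inr d) (.inl a) → g a d ≤ 1 ∧ ∃ u T, dem u = 3 ∧ r a u ∧
      Tiled (WeakBarrierPiece r dem) T ∧ .inl a ∉ T ∧ .inr u ∉ T ∧
      descendants R (.inl a) = insert (.inl a) (insert (.inr u) T) := fun a ha =>
    ((ih a ha).parent d ha).resolve_left (hgood a ha)
  have hd_notMem : ∀ a, R (.inr d) (.inl a) → .inr d ∉ descendants R (.inl a) := fun a ha =>
    notMem_descendants_of_rel hlt ha
  rcases hdem d with h0 | h2 | h3
  · left
    simpa using retile ∅ ∅ (by simp) (by simp)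
      (by simpa using Tiled.of_piece (.inl (BarrierPiece.single h0)))
  · by_cases hex : ∃ a, R (.inr d) (.inl a)
    · obtain ⟨a, ha⟩ := hex
      obtain ⟨-, u, T, hu, hau, hT, haT, huT, heq⟩ := hbad a ha
      have hda := hd_notMem a ha
      left
      simpa using retile {.inl a} ∅ (by simpa using ha) (by simp) (by
        simp only [mem_singleton_iff, iUnion_iUnion_eq_left, empty_union]
        rw [heq] at hda ⊢
        simp only [mem_insert_iff, reduceCtorEq, Sum.inr.injEq, false_or, not_or] at hda
        have := Tiled.weak_union (BarrierPiece.cherry h2 (hrR a ha) hau hda.1) hT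
          (by simp [haT, huT, hda.2])
        simpa [insert_union] using this)
    · right; left
      push Not at hex
      have hc : childWeight g rank d = 0 := by
        rw [childWeight, Finset.filter_false_of_mem (fun a _ => hex a), Finset.sum_empty]
      refine ⟨by lia, fun a d' ha hd' hrd hrd' => ?_⟩
      have hne : d ≠ d' := by rintro rfl; exact hd' self_mem_descendants
      have := retile ∅ {.inl a, .inr d'} (by simp) (by
        rw [disjoint_insert_left, disjoint_singleton_left]; exact ⟨ha, hd'⟩) (by
        refine (Tiled.of_piece (.inl (BarrierPiece.cherry h2 hrd hrd' hne))).congr ?_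
        ext x; simp only [mem_union, mem_insert_iff, mem_singleton_iff, mem_iUnion,
          mem_empty_iff_false]; tauto)
      simpa [insert_union] using this
  · by_cases hex : ∃ a, R (.inr d) (.inl a)
    · obtain ⟨a, ha⟩ := hex
      obtain ⟨hga, u, T, hu, hau, hT, haT, huT, heq⟩ := hbad a ha
      have hda := hd_notMem a ha
      by_cases hex' : ∃ a', R (.inr d) (.inl a') ∧ a ≠ a'
      · obtain ⟨a', ha', haa⟩ := hex'
        obtain ⟨hga', u', T', hu', hau', hT', haT', huT', heq'⟩ := hbad a' ha'
        have hda' := hd_notMem a' ha'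
        have hdis := disjoint_descendants hlt huniq ha ha' (by simpa using haa)
        left
        simpa using retile {.inl a, .inl a'} ∅ (by simp [ha, ha']) (by simp) (by
          rw [biUnion_pair]
          rw [heq] at hda hdis ⊢
          rw [heq'] at hda' hdis ⊢
          simp only [mem_insert_iff, reduceCtorEq, Sum.inr.injEq, false_or, not_or,
            disjoint_insert_left, disjoint_insert_right, Sum.inl.injEq] at hda hda' hdis
          have hTT := hT.disjUnion hT' hdis.2.2.2.2
          have := Tiled.weak_union (BarrierPiece.path h3 hau (hrR a ha) (hrR a' ha') hau' haa
            (Ne.symm hda.1) (by tauto) hda'.1) hTT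
            (by simp; tauto)
          refine this.congr ?_
          ext x; simp only [mem_union, mem_insert_iff, mem_singleton_iff, mem_empty_iff_false]
          tauto)
      · push Not at hex'
        right; left
        have hc : childWeight g rank d ≤ 1 := by
          refine le_trans (Finset.sum_le_sum_of_subset (t := {a}) ?_) (by simpa using hga)
          intro a' ha'
          simp only [Finset.mem_filter] at ha'
          simpa using (hex' a' ha'.2).symm
        refine ⟨by lia, fun a' d' ha' hd' hrd hrd' => ?_⟩
        have hne : d ≠ d' := by rintro rfl; exact hd' self_mem_descendants
        have hsub := descendants_subset_of_rel ha
        have hd'a := fun h => hd' (hsub h)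
        have ha'a := fun h => ha' (hsub h)
        have := retile {.inl a} {.inl a', .inr d'} (by simpa using ha) (by
          rw [disjoint_insert_left, disjoint_singleton_left]; exact ⟨ha', hd'⟩) (by
          simp only [mem_singleton_iff, iUnion_iUnion_eq_left]
          rw [heq] at hda hd'a ha'a ⊢
          simp only [mem_insert_iff, reduceCtorEq, Sum.inr.injEq, Sum.inl.injEq, false_or, imp_false,
            not_or] at hda hd'a ha'a
          have := Tiled.weak_union (BarrierPiece.path h3 hau (hrR a ha) hrd hrd' (Ne.symm ha'a.1)
            (Ne.symm hda.1) (Ne.symm hd'a.1) hne) hT (by simp; tauto)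
          refine this.congr ?_
          ext x; simp only [mem_union, mem_insert_iff, mem_singleton_iff]
          tauto)
        simpa [insert_union] using this
    · right; right
      push Not at hex
      refine ⟨h3, ?_⟩
      rw [childWeight, Finset.filter_false_of_mem (fun a _ => hex a), Finset.sum_empty]

/-- A child whose subtree cannot be tiled takes at least 2 of the 4 units of `a`. Two such children
take exactly 2 each and exhaust `a`, and one of them is tiled through `a` into the other. If there
is just one such child `d`, the edge `a d` tiles the subtree; towards a parent, `d` is either a leaf
of weight 3, which leaves at most 1 unit for the parent and serves as the spare `u`, or it can be
tiled through `a` together with the parent. With no such child, `a` stands alone or pairs with its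
parent. -/
theorem barrierState_of_children [Fintype D]
    (huniq : ∀ x y z, ForestChild g rank x z → ForestChild g rank y z → x = y)
    (hr : ∀ a d, 0 < g a d → r a d)
    (hg : ∀ a d, ForestChild g rank (.inl a) (.inr d) → g a d + childWeight g rank d = dem d)
    (a : A) (hcap : ∑ d, g a d ≤ 4)
    (ih : ∀ d, ForestChild g rank (.inl a) (.inr d) → ComponentState g rank r dem d) :
    BarrierState g rank r dem a := by
  classical
  set R := ForestChild g rank with hR
  have hlt : ∀ x y, R x y → rank x < rank y := ForestChild.rank_lt
  have hch : ∀ c, R (.inl a) c → ∃ d, c = .inr d := by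
    intro c hc
    cases hc with | down h1 h2 => exact ⟨_, rfl⟩
  have hgR : ∀ d, R (.inl a) (.inr d) → 0 < g a d := by
    intro d h
    cases h with | down h1 h2 => exact h1
  have hgR' : ∀ d, R (.inr d) (.inl a) → 0 < g a d := by
    intro d h
    cases h with | up h1 h2 => exact h1
  have hRR : ∀ d d', R (.inl a) (.inr d) → R (.inr d') (.inl a) → d ≠ d' := by
    rintro d d' h h' rfl
    exact (hlt _ _ h).asymm (hlt _ _ h')
  have hsum2 : ∀ d d', d ≠ d' → g a d + g a d' ≤ 4 := by
    intro d d' hdd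
    rw [← Finset.sum_pair (f := g a) hdd]
    exact (Finset.sum_le_sum_of_subset (Finset.subset_univ _)).trans hcap
  have hsum3 : ∀ d d' d'', d ≠ d' → d ≠ d'' → d' ≠ d'' → g a d + g a d' + g a d'' ≤ 4 := by
    intro d d' d'' h1 h2 h3
    have : ∑ x ∈ {d, d', d''}, g a x = g a d + (g a d' + g a d'') := by
      rw [Finset.sum_insert (by simp [h1, h2]), Finset.sum_pair h3]
    rw [add_assoc, ← this]
    exact (Finset.sum_le_sum_of_subset (Finset.subset_univ _)).trans hcap
  have hheavy : ∀ d, R (.inl a) (.inr d) → ¬ Tiled (WeakBarrierPiece r dem) (descendants R (.inr d)) →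
      (g a d = 3 ∧ dem d = 3) ∨ (2 ≤ g a d ∧ ∀ d', .inl a ∉ descendants R (.inr d) →
      .inr d' ∉ descendants R (.inr d) → r a d → r a d' →
      Tiled (WeakBarrierPiece r dem)
        (insert (.inl a) (insert (.inr d') (descendants R (.inr d))))) := by
    intro d hd hn
    have h := hg a d hd
    rcases (ih d hd).cases.resolve_left hn with h' | h'
    · exact .inr ⟨by lia, fun d' => h'.2 a d'⟩
    · exact .inl ⟨by lia, h'.1⟩
  have hheavy2 : ∀ d, R (.inl a) (.inr d) →
      ¬ Tiled (WeakBarrierPiece r dem) (descendants R (.inr d)) → 2 ≤ g a d := by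
    intro d hd hn
    rcases hheavy d hd hn with h | h <;> lia
  have retile : ∀ (J : Set (A ⊕ D)) (E : Set (A ⊕ D)), (∀ c ∈ J, R (.inl a) c) →
      Disjoint E (descendants R (.inl a)) →
      (∀ d, R (.inl a) (.inr d) → .inr d ∉ J →
        Tiled (WeakBarrierPiece r dem) (descendants R (.inr d))) →
      Tiled (WeakBarrierPiece r dem) (E ∪ insert (.inl a) (⋃ c ∈ J, descendants R c)) →
      Tiled (WeakBarrierPiece r dem) (E ∪ descendants R (.inl a)) := fun J E hJ hE hJ' h =>
    Tiled.descendants_union hlt huniq hJ hE h fun c hc hcJ => by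
      obtain ⟨d, rfl⟩ := hch c hc
      exact hJ' d hc hcJ
  by_cases hall : ∀ d, R (.inl a) (.inr d) → Tiled (WeakBarrierPiece r dem) (descendants R (.inr d))
  · refine ⟨?_, fun p hp => .inl ?_⟩
    · simpa using retile ∅ ∅ (by simp) (by simp) (fun d hd _ => hall d hd)
        (by simpa using Tiled.of_piece (Piece := WeakBarrierPiece r dem) (.inr ⟨a, rfl⟩))
    · have hedge := Tiled.of_piece (Piece := WeakBarrierPiece r dem)
        (.inl (.edge (hr a p (hgR' p hp))))
      simpa using retile ∅ {.inr p} (by simp)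
        (by simpa using notMem_descendants_of_rel hlt hp) (fun d hd _ => hall d hd)
        (by simpa [pair_comm] using hedge)
  push Not at hall
  obtain ⟨d, hd, hdT⟩ := hall
  have hrd := hr a d (hgR d hd)
  have had := notMem_descendants_of_rel hlt hd
  have hdself := (ih d hd).diff_self
  have hdeq : descendants R (.inr d) = insert (.inr d) (descendants R (.inr d) \ {.inr d}) := by
    rw [insert_sdiff_self_of_mem self_mem_descendants]
  set T := descendants R (.inr d) \ {.inr d} with hTdef
  have hdT' : Sum.inr d ∉ T := by simp [hTdef]
  have haT' : Sum.inl a ∉ T := fun h => had h.1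
  by_cases hall' : ∃ d', R (.inl a) (.inr d') ∧ d ≠ d' ∧
      ¬ Tiled (WeakBarrierPiece r dem) (descendants R (.inr d'))
  · obtain ⟨d', hd', hdd, hdT'⟩ := hall'
    have h2 := hheavy2 d hd hdT
    have h2' := hheavy2 d' hd' hdT'
    have h22 := hsum2 d d' hdd
    refine ⟨?_, fun p hp => ?_⟩
    · have had' := notMem_descendants_of_rel hlt hd'
      have hdis := disjoint_descendants hlt huniq hd hd' (by simpa using hdd)
      have hself' := (ih d' hd').diff_self
      have hmem' : Sum.inr d' ∉ descendants R (.inr d) := fun h =>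
        Set.disjoint_left.1 hdis h self_mem_descendants
      -- Both weights equal 2, so `d` is not a leaf of weight 3 and its state allows the path
      -- through `a` to `d'`.
      have key := ((hheavy d hd hdT).resolve_left (by lia)).2 d' had hmem' hrd
        (hr a d' (hgR d' hd'))
      have hrest : ∀ d₃, R (.inl a) (.inr d₃) → .inr d₃ ∉ ({.inr d, .inr d'} : Set (A ⊕ D)) →
          Tiled (WeakBarrierPiece r dem) (descendants R (.inr d₃)) := by
        intro d₃ hd₃ hne
        simp only [mem_insert_iff, Sum.inr.injEq, mem_singleton_iff, not_or] at hne
        have := hsum3 d d' d₃ hdd (Ne.symm hne.1) (Ne.symm hne.2)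
        have := hgR d₃ hd₃
        lia
      have hdeq' : descendants R (.inr d') =
          insert (.inr d') (descendants R (.inr d') \ {.inr d'}) := by
        rw [insert_sdiff_self_of_mem self_mem_descendants]
      have := retile {.inr d, .inr d'} ∅ (by simp [hd, hd']) (by simp) hrest (by
        rw [biUnion_pair]
        refine key.of_union_eq hself' ?_ ?_
        · simp only [disjoint_insert_left, mem_sdiff, mem_singleton_iff, not_true, and_false,
            not_false_eq_true, true_and]
          exact ⟨fun h => had' h.1, hdis.mono_right sdiff_subset⟩
        · conv_lhs => rw [hdeq']
          ext x
          simp only [mem_union, mem_insert_iff, mem_empty_iff_false]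
          tauto)
      simpa using this
    -- A parent would carry positive weight beyond the exhausted capacity, so `a` has none.
    · have := hsum3 d d' p hdd (hRR d p hd hp) (hRR d' p hd' hp)
      have := hgR' p hp
      lia
  · push Not at hall'
    have hJ' : ∀ d', R (.inl a) (.inr d') → .inr d' ∉ ({.inr d} : Set (A ⊕ D)) →
        Tiled (WeakBarrierPiece r dem) (descendants R (.inr d')) := fun d' hd' hne =>
      hall' d' hd' (by simpa [eq_comm] using hne)
    refine ⟨?_, fun p hp => ?_⟩
    · simpa using retile {.inr d} ∅ (by simpa using hd) (by simp) hJ' (by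
        simp only [mem_singleton_iff, iUnion_iUnion_eq_left, empty_union]
        rw [hdeq]
        have := Tiled.weak_union (BarrierPiece.edge hrd) hdself (by simp [haT', hdT'])
        simpa [insert_union] using this)
    · have hpa := notMem_descendants_of_rel hlt hp
      rcases hheavy d hd hdT with ⟨h3, hdem3⟩ | ⟨h2, key⟩
      · right
        obtain ⟨X, hX, hdis, heq⟩ := Tiled.exists_descendants_eq_union (J := {.inr d}) hlt huniq
          (by simpa using hd) (fun c hc hcJ => by
            obtain ⟨d', rfl⟩ := hch c hc
            exact hJ' d' hc hcJ)
        simp only [mem_singleton_iff, iUnion_iUnion_eq_left] at hdis heq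
        rw [hdeq] at hdis heq
        simp only [disjoint_insert_left] at hdis
        refine ⟨by have := hsum2 d p (hRR d p hd hp); lia, d, T ∪ X, hdem3, hrd,
          hdself.disjUnion hX hdis.2.2, ?_, ?_, by rw [heq, insert_union, insert_union]⟩
        · rw [mem_union]; tauto
        · rw [mem_union]; tauto
      · left
        simpa using retile {.inr d} {.inr p} (by simpa using hd) (by simpa using hpa) hJ' (by
          simp only [mem_singleton_iff, iUnion_iUnion_eq_left]
          refine (key p had (fun h => hpa (descendants_subset_of_rel hd h)) hrd
            (hr a p (hgR' p hp))).congr ?_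
          ext x; simp only [mem_union, mem_insert_iff, mem_singleton_iff]
          tauto)

end WeightedForest

/-! ### The induction over the forest -/

section RootedForest

variable {A D : Type*} [Fintype A] [Fintype D] {g : A → D → ℕ} {rank : A ⊕ D → ℕ}
  {r : A → D → Prop} {dem : D → ℕ}

/-- A bipartite forest whose edge weights satisfy all demands, up to one unit at one root, without
exceeding the capacity `4` of the barrier vertices yields a tiling. -/
theorem tiled_of_rooted_forest {e : D → ℕ}
    (hrank : ∀ a d, 0 < g a d → rank (.inl a) ≠ rank (.inr d))
    (huniq : ∀ x y z, ForestChild g rank x z → ForestChild g rank y z → x = y)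
    (hdem : ∀ d, dem d = 0 ∨ dem d = 2 ∨ dem d = 3) (hr : ∀ a d, 0 < g a d → r a d)
    (hcap : ∀ a, ∑ d, g a d ≤ 4) (hsum : ∀ d, ∑ a, g a d + e d = dem d) (he : ∀ d, e d ≤ 1)
    (hroot : ∀ a d, 0 < e d → ¬ ForestChild g rank (.inl a) (.inr d)) :
    Tiled (WeakBarrierPiece r dem) univ := by
  classical
  have hlt : ∀ x y, ForestChild g rank x y → rank x < rank y := ForestChild.rank_lt
  have hor : ∀ a d, 0 < g a d →
      ForestChild g rank (.inl a) (.inr d) ∨ ForestChild g rank (.inr d) (.inl a) := by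
    intro a d h
    rcases lt_or_gt_of_ne (hrank a d h) with h' | h'
    · exact .inl (.down h h')
    · exact .inr (.up h h')
  have hg : ∀ a d, ForestChild g rank (.inl a) (.inr d) →
      g a d + childWeight g rank d = dem d := by
    intro a d h
    -- The unmet unit sits at a root, so at a component with a parent the parent and the children
    -- together meet the demand exactly.
    have he0 : e d = 0 := by
      by_contra h0
      exact hroot a d (Nat.pos_of_ne_zero h0) h
    have hsplit := Finset.sum_filter_add_sum_filter_not Finset.univ
      (fun a => ForestChild g rank (.inr d) (.inl a)) (fun a => g a d)
    rw [← hsum d, he0, add_zero, childWeight, ← hsplit, add_comm]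
    congr 1
    rw [Finset.sum_eq_single a]
    · intro b hb hba
      simp only [Finset.mem_filter, Finset.mem_univ, true_and] at hb
      by_contra h0
      rcases hor b d (Nat.pos_of_ne_zero h0) with h1 | h1
      · exact hba (Sum.inl_injective (huniq _ _ _ h1 h))
      · exact hb h1
    · intro ha
      simp only [Finset.mem_filter, Finset.mem_univ, true_and, not_not] at ha
      exact ((hlt _ _ h).asymm (hlt _ _ ha)).elim
  have main : ∀ v : A ⊕ D, (∀ a, v = .inl a → BarrierState g rank r dem a) ∧
      ∀ d, v = .inr d → ComponentState g rank r dem d := by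
    intro v
    induction hn : (descendants (ForestChild g rank) v).ncard using Nat.strong_induction_on
      generalizing v with
    | _ n ih =>
    have hlt' : ∀ c, ForestChild g rank v c →
        (descendants (ForestChild g rank) c).ncard < n := by
      intro c hc
      rw [← hn]
      refine ncard_lt_ncard ⟨descendants_subset_of_rel hc, fun h => ?_⟩ (toFinite _)
      exact notMem_descendants_of_rel hlt hc (h self_mem_descendants)
    constructor
    · rintro a rfl
      exact barrierState_of_children huniq hr hg a (hcap a) fun d hd =>
        (ih _ (hlt' _ hd) _ rfl).2 d rfl
    · rintro d rfl
      exact componentState_of_children huniq hdem hr d fun a ha =>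
        (ih _ (hlt' _ ha) _ rfl).1 a rfl
  refine Tiled.univ_of_roots hlt huniq fun v hv => ?_
  rcases v with a | d
  · exact ((main _).1 a rfl).tiled
  · have hc : childWeight g rank d + e d = dem d := by
      rw [← hsum d, childWeight, Finset.sum_filter_of_ne]
      intro a _ h0
      exact (hor a d (Nat.pos_of_ne_zero h0)).resolve_left (hv _)
    have hed := he d
    -- At a root the children supply at least `dem d - 1`, which excludes the two states without a
    -- tiling.
    rcases ((main _).2 d rfl).cases with h | ⟨h, -⟩ | ⟨h, h'⟩
    · exact h
    · lia
    · lia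

end RootedForest

/-! ### Rooting acyclic graphs; dart counts of walks -/

namespace SimpleGraph

variable {V : Type*} {H : SimpleGraph V}

/-- An acyclic graph can be rooted at any set of vertices that meets each component at most
once. -/
theorem IsAcyclic.exists_rank (hH : H.IsAcyclic) {R : Set V}
    (hR : ∀ x ∈ R, ∀ y ∈ R, H.Reachable x y → x = y) :
    ∃ rank : V → ℕ, (∀ x y, H.Adj x y → rank x ≠ rank y) ∧
      (∀ x y z, H.Adj x z → rank x < rank z → H.Adj y z → rank y < rank z → x = y) ∧
      ∀ x ∈ R, rank x = 0 := by
  classical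
  -- `ρ` sends a vertex to the root of its component, taken in `R` if the component meets `R`; the
  -- rank will be the distance to this root.
  obtain ⟨ρ, hρ, hρa, hρR⟩ : ∃ ρ : V → V, (∀ v, H.Reachable (ρ v) v) ∧
      (∀ v w, H.Adj v w → ρ v = ρ w) ∧ ∀ x ∈ R, ρ x = x := by
    let σ : H.ConnectedComponent → V := fun C =>
      if h : ∃ x ∈ R, H.connectedComponentMk x = C then h.choose else C.out
    have hσ : ∀ C, H.connectedComponentMk (σ C) = C := by
      intro C
      by_cases h : ∃ x ∈ R, H.connectedComponentMk x = C
      · simp only [σ, dif_pos h]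
        exact h.choose_spec.2
      · simp only [σ, dif_neg h]
        exact C.out_eq
    refine ⟨fun v => σ (H.connectedComponentMk v), fun v => ?_, fun v w h => ?_, fun x hx => ?_⟩
    · exact ConnectedComponent.eq.1 (hσ _)
    · exact congrArg σ (ConnectedComponent.eq.2 h.reachable)
    · have h : ∃ y ∈ R, H.connectedComponentMk y = H.connectedComponentMk x := ⟨x, hx, rfl⟩
      have h1 : σ (H.connectedComponentMk x) = h.choose := by simp only [σ, dif_pos h]
      show σ (H.connectedComponentMk x) = x
      rw [h1]
      exact hR _ h.choose_spec.1 _ hx (ConnectedComponent.eq.1 h.choose_spec.2)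
  -- A geodesic from the root to `x` avoids `z`, so extending it by the edge to `z` gives a path,
  -- and paths in a forest are unique.
  have hpath : ∀ x z, H.Adj x z → H.dist (ρ x) x ≤ H.dist (ρ z) z →
      ∀ q : H.Walk (ρ z) z, q.IsPath → q.penultimate = x := by
    intro x z hxz hle q hq
    rw [hρa x z hxz] at hle
    obtain ⟨p, hp, hlen⟩ := (hρa x z hxz ▸ hρ x : H.Reachable (ρ z) x).exists_path_of_dist
    have hzp : z ∉ p.support := by
      intro hz
      have h1 := dist_le (p.takeUntil z hz)
      have h2 : (p.takeUntil z hz).length < p.length :=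
        p.length_takeUntil_lt_length hz hxz.ne'
      lia
    have h3 : (p.concat hxz).IsPath := hp.concat hzp hxz
    have h5 : q = p.concat hxz := congrArg Subtype.val
      ((hH.subsingleton_path _ _).elim ⟨q, hq⟩ ⟨p.concat hxz, h3⟩)
    rw [h5, Walk.penultimate_concat]
  refine ⟨fun v => H.dist (ρ v) v, ?_, ?_, fun x hx => by simp [hρR x hx]⟩
  · intro x z hxz heq
    obtain ⟨q, hq, hlen⟩ := (hρ z).exists_path_of_dist
    have h1 := hpath x z hxz heq.le q hq
    have hnil : ¬ q.Nil := by
      intro hn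
      have h0 : H.dist (ρ z) z = 0 := by rw [← hlen]; exact Walk.length_eq_zero_iff.2 hn
      have hz : ρ z = z := (hρ z).dist_eq_zero_iff.1 h0
      have hx : ρ x = x := (hρ x).dist_eq_zero_iff.1 (heq.trans h0)
      exact hxz.ne (by rw [← hx, hρa x z hxz, hz])
    have h2 := dist_le q.dropLast
    have h6 : H.dist (ρ z) q.penultimate = H.dist (ρ x) x := by rw [h1, hρa x z hxz]
    rw [h6] at h2
    have h3 := Walk.length_dropLast_add_one hnil
    have h4 : H.dist (ρ x) x = H.dist (ρ z) z := heq
    have h5 : q.dropLast.length = q.length - 1 := by lia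
    rw [h4, ← hlen] at h2
    lia
  · intro x y z hxz hx hyz hy
    obtain ⟨q, hq, -⟩ := (hρ z).exists_path_of_dist
    rw [← hpath x z hxz hx.le q hq, ← hpath y z hyz hy.le q hq]

open Classical in
/-- How often the walk traverses the edge from `x` to `y` in this direction. -/
noncomputable def Walk.dartCount : ∀ {u v : V}, H.Walk u v → V → V → ℕ
  | _, _, .nil, _, _ => 0
  | u, _, .cons (v := w) _ p, x, y => (if u = x ∧ w = y then 1 else 0) + p.dartCount x y

theorem Walk.adj_of_dartCount_pos {u v : V} (p : H.Walk u v) {x y : V}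
    (h : 0 < p.dartCount x y) : H.Adj x y := by
  induction p with
  | nil => simp [dartCount] at h
  | cons hadj p ih =>
    rw [dartCount] at h
    split_ifs at h with h'
    · rw [← h'.1, ← h'.2]; exact hadj
    · exact ih (by simpa using h)

theorem Walk.dartCount_add_le_count [DecidableEq V] {u v : V} (p : H.Walk u v) {x y : V}
    (hxy : x ≠ y) : p.dartCount x y + p.dartCount y x ≤ p.edges.count s(x, y) := by
  induction p with
  | nil => simp [dartCount]
  | @cons u w v hadj p ih =>
    rw [dartCount, dartCount, edges_cons, List.count_cons]
    by_cases h1 : u = x ∧ w = y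
    · have h2 : ¬ (u = y ∧ w = x) := fun h => hxy (h1.1.symm.trans h.1)
      simp only [h1, and_self, if_true, beq_self_eq_true]
      rw [if_neg (by tauto)]
      lia
    · by_cases h2 : u = y ∧ w = x
      · rw [if_neg h1, if_pos h2, if_pos (by simp [h2])]
        lia
      · rw [if_neg h1, if_neg h2]
        lia

/-- Outgoing minus incoming darts telescope along the walk. For a closed walk the right side
vanishes, so its net dart counts form a circulation. -/
theorem Walk.sum_dartCount [Fintype V] [DecidableEq V] {u v : V} (p : H.Walk u v) (x : V) :
    ∑ y, (p.dartCount x y : ℤ) - ∑ y, (p.dartCount y x : ℤ) =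
      (if u = x then 1 else 0) - (if v = x then 1 else 0) := by
  induction p with
  | nil => simp [dartCount]
  | @cons u w v hadj p ih =>
    have h1 : ∑ y, ((if u = x ∧ w = y then 1 else 0 : ℕ) : ℤ) = if u = x then 1 else 0 := by
      by_cases h : u = x <;> simp [h]
    have h2 : ∑ y, ((if u = y ∧ w = x then 1 else 0 : ℕ) : ℤ) = if w = x then 1 else 0 := by
      by_cases h : w = x <;> simp [h]
    simp only [dartCount, Nat.cast_add, Finset.sum_add_distrib]
    have h1' := h1
    have h2' := h2
    simp only [Nat.cast_ite, Nat.cast_one, Nat.cast_zero] at h1' h2' ⊢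
    lia

end SimpleGraph

/-! ### Transport weights: Hall's theorem and cycle cancelling -/

section Flow

variable {A D : Type*}

/-- The bipartite graph of the edges of positive weight. -/
def weightGraph (g : A → D → ℕ) : SimpleGraph (A ⊕ D) where
  Adj x y := (∃ a d, x = .inl a ∧ y = .inr d ∧ 0 < g a d) ∨
    ∃ a d, x = .inr d ∧ y = .inl a ∧ 0 < g a d
  symm := ⟨by
    rintro x y (⟨a, d, hx, hy, h⟩ | ⟨a, d, hx, hy, h⟩)
    · exact .inr ⟨a, d, hy, hx, h⟩
    · exact .inl ⟨a, d, hy, hx, h⟩⟩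
  loopless := ⟨by rintro (a | d) <;> simp⟩

variable {g : A → D → ℕ}

theorem weightGraph_adj_inl_inr {a : A} {d : D} :
    (weightGraph g).Adj (.inl a) (.inr d) ↔ 0 < g a d := by
  simp [weightGraph]

theorem not_weightGraph_adj_inl_inl {a a' : A} : ¬ (weightGraph g).Adj (.inl a) (.inl a') := by
  simp [weightGraph]

theorem not_weightGraph_adj_inr_inr {d d' : D} : ¬ (weightGraph g).Adj (.inr d) (.inr d') := by
  simp [weightGraph]

theorem ForestChild.adj {rank : A ⊕ D → ℕ} {x y : A ⊕ D} (h : ForestChild g rank x y) :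
    (weightGraph g).Adj x y := by
  cases h with
  | down h _ => exact weightGraph_adj_inl_inr.2 h
  | up h _ => exact (weightGraph_adj_inl_inr.2 h).symm

variable [Fintype A] [Fintype D]

/-- A cycle in the graph of positive edges gives a nonzero circulation that can be added to and
subtracted from the weights. -/
theorem exists_circulation_of_not_isAcyclic (h : ¬ (weightGraph g).IsAcyclic) :
    ∃ δ : A → D → ℤ, (∃ a d, δ a d ≠ 0) ∧ (∀ a d, |δ a d| ≤ g a d) ∧
      (∀ a, ∑ d, δ a d = 0) ∧ ∀ d, ∑ a, δ a d = 0 := by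
  classical
  unfold SimpleGraph.IsAcyclic at h
  push Not at h
  obtain ⟨v, c, hc⟩ := h
  have hzero : ∀ x y, ¬ (weightGraph g).Adj x y → c.dartCount x y = 0 := by
    intro x y hxy
    by_contra h0
    exact hxy (c.adj_of_dartCount_pos (Nat.pos_of_ne_zero h0))
  have hle : ∀ x y, x ≠ y → c.dartCount x y + c.dartCount y x ≤ 1 := fun x y hxy =>
    (c.dartCount_add_le_count hxy).trans (List.nodup_iff_count_le_one.1 hc.edges_nodup _)
  have hbal : ∀ x, ∑ y, (c.dartCount x y : ℤ) - ∑ y, (c.dartCount y x : ℤ) = 0 := by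
    intro x
    rw [c.sum_dartCount, sub_self]
  -- The net number of traversals from `a` to `d`. A cycle uses an edge at most once, so no
  -- cancellation occurs and the absolute value is at most 1.
  refine ⟨fun a d => c.dartCount (.inl a) (.inr d) - c.dartCount (.inr d) (.inl a), ?_, ?_, ?_, ?_⟩
  · have hnz : ∃ x y, 0 < c.dartCount x y := by
      cases c with
      | nil => exact (hc.ne_nil rfl).elim
      | @cons _ w _ hadj p => exact ⟨v, w, by simp [SimpleGraph.Walk.dartCount]⟩
    obtain ⟨x, y, hxy⟩ := hnz
    have h1 := hle x y (c.adj_of_dartCount_pos hxy).ne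
    rcases c.adj_of_dartCount_pos hxy with ⟨a, d, rfl, rfl, -⟩ | ⟨a, d, rfl, rfl, -⟩
    · exact ⟨a, d, by lia⟩
    · exact ⟨a, d, by lia⟩
  · intro a d
    have h1 := hle (.inl a) (.inr d) (by simp)
    rw [abs_le]
    by_cases hg : 0 < g a d
    · constructor <;> lia
    · have h2 := hzero (.inl a) (.inr d) (by rwa [weightGraph_adj_inl_inr])
      have h3 := hzero (.inr d) (.inl a) (by
        rwa [SimpleGraph.adj_comm, weightGraph_adj_inl_inr])
      constructor <;> lia
  · intro a
    have := hbal (.inl a)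
    simpa [Fintype.sum_sum_type, hzero _ _ not_weightGraph_adj_inl_inl,
      Finset.sum_sub_distrib] using this
  · intro d
    have := hbal (.inr d)
    simp only [Fintype.sum_sum_type, hzero _ _ not_weightGraph_adj_inr_inr, Nat.cast_zero,
      Finset.sum_const_zero, add_zero] at this
    rw [Finset.sum_sub_distrib]
    lia

/-- Among all weights with the same marginals, there is one whose positive edges form a forest. -/
theorem exists_isAcyclic_weightGraph (g : A → D → ℕ) :
    ∃ g' : A → D → ℕ, (∀ a d, 0 < g' a d → 0 < g a d) ∧ (∀ a, ∑ d, g' a d = ∑ d, g a d) ∧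
      (∀ d, ∑ a, g' a d = ∑ a, g a d) ∧ (weightGraph g').IsAcyclic := by
  classical
  let F : Set (A → D → ℕ) := {g' | (∀ a d, 0 < g' a d → 0 < g a d) ∧
    (∀ a, ∑ d, g' a d = ∑ d, g a d) ∧ ∀ d, ∑ a, g' a d = ∑ a, g a d}
  have hfin : F.Finite := by
    refine (Set.finite_Iic (fun a (_ : D) => ∑ d, g a d)).subset fun g' hg' a d => ?_
    show g' a d ≤ ∑ d, g a d
    rw [← hg'.2.1 a]
    exact Finset.single_le_sum (f := g' a) (fun _ _ => Nat.zero_le _) (Finset.mem_univ d)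
  -- The sum of squares is strictly convex, so a maximizer is not the midpoint of `g' + δ` and `g' -
  -- δ` for a nonzero circulation `δ`.
  obtain ⟨g', hg', hmax⟩ := hfin.exists_maximalFor (fun g' => ∑ a, ∑ d, (g' a d : ℤ) ^ 2) F
    ⟨g, fun _ _ h => h, fun _ => rfl, fun _ => rfl⟩
  refine ⟨g', hg'.1, hg'.2.1, hg'.2.2, ?_⟩
  by_contra hcyc
  obtain ⟨δ, ⟨a₀, d₀, hne⟩, habs, hrow, hcol⟩ := exists_circulation_of_not_isAcyclic hcyc
  have key : ∀ ε : ℤ, |ε| ≤ 1 →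
      ∑ a, ∑ d, ((g' a d : ℤ) + ε * δ a d) ^ 2 ≤ ∑ a, ∑ d, (g' a d : ℤ) ^ 2 := by
    intro ε hε
    have hεδ : ∀ a d, |ε * δ a d| ≤ g' a d := fun a d => by
      rw [abs_mul]
      exact (mul_le_of_le_one_left (abs_nonneg _) hε).trans (habs a d)
    have hnn : ∀ a d, (((g' a d : ℤ) + ε * δ a d).toNat : ℤ) = g' a d + ε * δ a d := fun a d =>
      Int.toNat_of_nonneg (by have := (abs_le.1 (hεδ a d)).1; lia)
    have hmem : (fun a d => ((g' a d : ℤ) + ε * δ a d).toNat) ∈ F := by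
      refine ⟨fun a d h => hg'.1 a d ?_, fun a => ?_, fun d => ?_⟩
      · by_contra h0
        have h1 := abs_le.1 (hεδ a d)
        have h2 : g' a d = 0 := by lia
        rw [h2] at h1
        simp only [h2] at h
        lia
      · rw [← hg'.2.1 a]
        zify
        simp only [hnn, Finset.sum_add_distrib, ← Finset.mul_sum, hrow, mul_zero, add_zero]
      · rw [← hg'.2.2 d]
        zify
        simp only [hnn, Finset.sum_add_distrib, ← Finset.mul_sum, hcol, mul_zero, add_zero]
    have := hmax hmem
    simp only [hnn] at this
    by_contra hlt
    exact hlt (this (not_le.1 hlt).le)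
  have h1 := key 1 (by simp)
  have h2 := key (-1) (by simp)
  have h3 : ∑ a, ∑ d, ((g' a d : ℤ) + 1 * δ a d) ^ 2 + ∑ a, ∑ d, ((g' a d : ℤ) + -1 * δ a d) ^ 2 =
      2 * ∑ a, ∑ d, (g' a d : ℤ) ^ 2 + 2 * ∑ a, ∑ d, (δ a d) ^ 2 := by
    simp only [Finset.mul_sum, ← Finset.sum_add_distrib]
    refine Finset.sum_congr rfl fun a _ => Finset.sum_congr rfl fun d _ => ?_
    ring
  have h4 : 0 < ∑ a, ∑ d, (δ a d) ^ 2 := by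
    refine Finset.sum_pos' (fun a _ => Finset.sum_nonneg fun d _ => sq_nonneg _)
      ⟨a₀, Finset.mem_univ _, ?_⟩
    exact Finset.sum_pos' (fun d _ => sq_nonneg _) ⟨d₀, Finset.mem_univ _, by positivity⟩
  lia

/-- A weighted form of Hall's theorem with capacities `k` and deficiency one. -/
theorem exists_weights_of_hall (r : A → D → Prop) (dem : D → ℕ) (k : ℕ)
    (h : ∀ (X : Finset A) (Y : Finset D), (∀ a, ∀ d ∈ Y, r a d → a ∈ X) →
      ∑ d ∈ Y, dem d ≤ k * X.card + 1) :
    ∃ (g : A → D → ℕ) (e : D → ℕ), (∀ a d, 0 < g a d → r a d) ∧ (∀ a, ∑ d, g a d ≤ k) ∧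
      (∀ d, ∑ a, g a d + e d = dem d) ∧ ∑ d, e d ≤ 1 := by
  classical
  -- Units of demand are matched to the `k` copies of each barrier vertex; the extra target `none`,
  -- open to every unit, takes the one that may stay unmet.
  let t : (Σ d, Fin (dem d)) → Finset (Option (A × Fin k)) := fun p =>
    Finset.insertNone (Finset.univ.filter (fun q : A × Fin k => r q.1 p.1))
  have hall : ∀ s : Finset (Σ d, Fin (dem d)), s.card ≤ (s.biUnion t).card := by
    intro s
    rcases s.eq_empty_or_nonempty with rfl | ⟨p₀, hp₀⟩
    · simp
    let Y := s.image Sigma.fst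
    let X : Finset A := Finset.univ.filter fun a => ∃ d ∈ Y, r a d
    have h1 : s.card ≤ ∑ d ∈ Y, dem d := by
      have : s ⊆ Y.sigma fun _ => Finset.univ := fun p hp =>
        Finset.mem_sigma.2 ⟨Finset.mem_image_of_mem _ hp, Finset.mem_univ _⟩
      simpa using Finset.card_le_card this
    have h2 : s.biUnion t = Finset.insertNone (X ×ˢ (Finset.univ : Finset (Fin k))) := by
      ext q
      cases q with
      | none => simpa [t] using ⟨p₀.1, p₀.2, hp₀⟩
      | some q => simp [t, X, Y]
    rw [h2, Finset.card_insertNone, Finset.card_product, Finset.card_univ, Fintype.card_fin,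
      mul_comm]
    exact h1.trans (h X Y fun a d hd had =>
      Finset.mem_filter.2 ⟨Finset.mem_univ _, d, hd, had⟩)
  obtain ⟨f, hf, hft⟩ := (Finset.all_card_le_biUnion_card_iff_exists_injective t).1 hall
  have hsig : ∀ o : Option A, ∑ d, ({i : Fin (dem d) | (f ⟨d, i⟩).map Prod.fst = o} :
      Finset (Fin (dem d))).card = ({p | (f p).map Prod.fst = o} :
        Finset (Σ d, Fin (dem d))).card := by
    intro o
    rw [← Finset.card_sigma]
    congr 1
    ext p
    simp
  refine ⟨fun a d => ({i | (f ⟨d, i⟩).map Prod.fst = some a} : Finset (Fin (dem d))).card,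
    fun d => ({i | (f ⟨d, i⟩).map Prod.fst = none} : Finset (Fin (dem d))).card, ?_, ?_, ?_, ?_⟩
  · intro a d hpos
    obtain ⟨i, hi⟩ := Finset.card_pos.1 hpos
    obtain ⟨q, hq, rfl⟩ := Option.map_eq_some_iff.1 (Finset.mem_filter.1 hi).2
    have := hft ⟨d, i⟩
    rw [hq] at this
    simpa [t] using this
  · intro a
    rw [hsig (some a)]
    have hsub : ({p | (f p).map Prod.fst = some a} : Finset (Σ d, Fin (dem d))).image f ⊆
        Finset.univ.image fun j : Fin k => some (a, j) := by
      intro q hq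
      obtain ⟨p, hp, rfl⟩ := Finset.mem_image.1 hq
      obtain ⟨⟨b, j⟩, hb, rfl⟩ := Option.map_eq_some_iff.1 (Finset.mem_filter.1 hp).2
      exact Finset.mem_image.2 ⟨j, Finset.mem_univ _, hb.symm⟩
    rw [← Finset.card_image_of_injective _ hf]
    exact (Finset.card_le_card hsub).trans (Finset.card_image_le.trans (by simp))
  · intro d
    have h1 := Finset.card_eq_sum_card_fiberwise (s := (Finset.univ : Finset (Fin (dem d))))
      (t := Finset.univ) (f := fun i => (f ⟨d, i⟩).map Prod.fst) (fun _ _ => Finset.mem_univ _)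
    rw [Fintype.sum_option, Finset.card_univ, Fintype.card_fin] at h1
    rw [add_comm]
    exact h1.symm
  · rw [hsig none, Finset.card_le_one]
    intro p hp q hq
    simp only [Finset.mem_filter, Finset.mem_univ, true_and, Option.map_eq_none_iff] at hp hq
    exact hf (hp.trans hq.symm)

/-- The covering theorem for the bipartite graph between a barrier and its components. -/
theorem tiled_weakBarrierPiece {r : A → D → Prop} {dem : D → ℕ}
    (hdem : ∀ d, dem d = 0 ∨ dem d = 2 ∨ dem d = 3)
    (h : ∀ (X : Finset A) (Y : Finset D), (∀ a, ∀ d ∈ Y, r a d → a ∈ X) →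
      ∑ d ∈ Y, dem d ≤ 4 * X.card + 1) :
    Tiled (WeakBarrierPiece r dem) univ := by
  obtain ⟨g₀, e, hr, hcap, hsum, he⟩ := exists_weights_of_hall r dem 4 h
  obtain ⟨g, hg, hrow, hcol, hacyc⟩ := exists_isAcyclic_weightGraph g₀
  have he1 : ∀ d, e d ≤ 1 := fun d =>
    (Finset.single_le_sum (f := e) (fun _ _ => Nat.zero_le _) (Finset.mem_univ d)).trans he
  -- As `e` sums to at most 1, it is positive at one component at most, which can therefore be made
  -- a root.
  obtain ⟨rank, h1, h2, h3⟩ := hacyc.exists_rank (R := {x | ∃ d, x = .inr d ∧ 0 < e d}) (by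
    classical
    rintro _ ⟨d, rfl, hd⟩ _ ⟨d', rfl, hd'⟩ -
    by_contra hne
    have hdd : d ≠ d' := by rintro rfl; exact hne rfl
    have := Finset.sum_le_sum_of_subset (f := e) (Finset.subset_univ {d, d'})
    rw [Finset.sum_pair hdd] at this
    lia)
  refine tiled_of_rooted_forest (g := g) (rank := rank) (e := e)
    (fun a d had => h1 _ _ (weightGraph_adj_inl_inr.2 had))
    (fun x y z hx hy => h2 x y z hx.adj (ForestChild.rank_lt _ _ hx) hy.adj
      (ForestChild.rank_lt _ _ hy)) hdem (fun a d had => hr a d (hg a d had))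
    (fun a => (hrow a).trans_le (hcap a)) (fun d => by rw [hcol, hsum]) he1 ?_
  intro a d hd hchild
  have := ForestChild.rank_lt _ _ hchild
  rw [h3 (.inr d) ⟨d, rfl, hd⟩] at this
  lia

end Flow

/-! ### Components of induced subgraphs and Tutte's theorem -/

namespace SimpleGraph

variable {V : Type*} {G : SimpleGraph V}

/-- `C` is the vertex set of a connected component of the subgraph of `G` induced by `Z`. -/
structure IsCompOf (G : SimpleGraph V) (Z C : Set V) : Prop where
  subset : C ⊆ Z
  connected : (G.induce C).Connected
  closed : ∀ u ∈ C, ∀ v ∈ Z, G.Adj u v → v ∈ C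

theorem IsCompOf.nonempty {Z C : Set V} (h : G.IsCompOf Z C) : C.Nonempty :=
  nonempty_coe_sort.1 h.connected.nonempty

theorem Connected.subset_of_closed {D C : Set V} (hD : (G.induce D).Connected)
    (hDC : (D ∩ C).Nonempty) (hcl : ∀ u ∈ C, ∀ v ∈ D, G.Adj u v → v ∈ C) : D ⊆ C := by
  obtain ⟨x, hxD, hxC⟩ := hDC
  intro y hy
  have key : ∀ a b : D, (G.induce D).Walk a b → (a : V) ∈ C → (b : V) ∈ C := by
    intro a b p
    induction p with
    | nil => exact id
    | @cons u v w h _ ih => exact fun ha => ih (hcl u ha v v.2 h)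
  exact key ⟨x, hxD⟩ ⟨y, hy⟩ (hD.preconnected _ _).some hxC

theorem IsCompOf.eq_of_inter {Z C D : Set V} (hC : G.IsCompOf Z C) (hD : G.IsCompOf Z D)
    (h : (C ∩ D).Nonempty) : C = D :=
  (hC.connected.subset_of_closed h fun u hu v hv => hD.closed u hu v (hC.subset hv)).antisymm
    (hD.connected.subset_of_closed (inter_comm C D ▸ h) fun u hu v hv =>
      hC.closed u hu v (hD.subset hv))

theorem IsCompOf.disjoint {Z C D : Set V} (hC : G.IsCompOf Z C) (hD : G.IsCompOf Z D)
    (h : C ≠ D) : Disjoint C D := by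
  rw [Set.disjoint_iff_inter_eq_empty]
  by_contra h0
  exact h (hC.eq_of_inter hD (nonempty_iff_ne_empty.2 h0))

section Embedding

variable {β : Type*} {K : SimpleGraph β} (f : K ↪g G)

theorem isCompOf_image_supp (c : K.ConnectedComponent) : G.IsCompOf (range f) (f '' c.supp) := by
  refine ⟨image_subset_range _ _, ?_, ?_⟩
  · have e : c.toSimpleGraph ≃g G.induce (f '' c.supp) :=
      { toEquiv := Equiv.Set.image f c.supp f.injective
        map_rel_iff' := by
          intro x y
          exact f.map_adj_iff }
    exact e.connected_iff.1 c.connected_toSimpleGraph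
  · rintro _ ⟨x, hx, rfl⟩ _ ⟨y, rfl⟩ hxy
    refine ⟨y, ?_, rfl⟩
    exact (c.mem_supp_congr_adj (f.map_adj_iff.1 hxy)).1 hx

theorem IsCompOf.exists_eq_image_supp {C : Set V} (hC : G.IsCompOf (range f) C) :
    ∃ c : K.ConnectedComponent, f '' c.supp = C := by
  obtain ⟨_, hx⟩ := hC.nonempty
  obtain ⟨y, rfl⟩ := hC.subset hx
  exact ⟨K.connectedComponentMk y,
    (isCompOf_image_supp f _).eq_of_inter hC ⟨f y, ⟨y, rfl, rfl⟩, hx⟩⟩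

/-- Stated for an arbitrary embedding to serve both induced subgraphs and the vertex-deleted
subgraphs in `tutte`. -/
theorem ncard_components_eq (P : ℕ → Prop) :
    {c : K.ConnectedComponent | P c.supp.ncard}.ncard =
      {C | G.IsCompOf (range f) C ∧ P C.ncard}.ncard := by
  have hinj : Function.Injective fun c : K.ConnectedComponent => f '' c.supp := fun c d h =>
    ConnectedComponent.supp_injective (image_injective.2 f.injective h)
  rw [← ncard_image_of_injective _ hinj]
  congr 1
  ext C
  constructor
  · rintro ⟨c, hc, rfl⟩
    exact ⟨isCompOf_image_supp f c, by rwa [ncard_image_of_injective _ f.injective]⟩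
  · rintro ⟨hC, hP⟩
    obtain ⟨c, rfl⟩ := hC.exists_eq_image_supp f
    exact ⟨c, by rwa [ncard_image_of_injective _ f.injective] at hP, rfl⟩

end Embedding

theorem ncard_induce_components_eq (Z : Set V) (P : ℕ → Prop) :
    {c : (G.induce Z).ConnectedComponent | P c.supp.ncard}.ncard =
      {C | G.IsCompOf Z C ∧ P C.ncard}.ncard := by
  have h := ncard_components_eq (Embedding.induce (G := G) Z) P
  have hr : range (Embedding.induce (G := G) Z) = Z := Subtype.range_coe
  rwa [hr] at h

/-- The number of odd components of the subgraph induced by `Z`. -/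
noncomputable def oddCompCount (G : SimpleGraph V) (Z : Set V) : ℕ :=
  {C | G.IsCompOf Z C ∧ Odd C.ncard}.ncard

theorem odd_oddCompCount [Finite V] (Z : Set V) : Odd (G.oddCompCount Z) ↔ Odd Z.ncard := by
  rw [oddCompCount, ← ncard_induce_components_eq, odd_ncard_oddComponents, Nat.card_coe_set_eq]

/-- Deleting a set `Y` from a component `C` leaves all other components. -/
theorem oddCompCount_add_le [Finite V] {Z C Y : Set V} (hC : G.IsCompOf Z C) (hY : Y ⊆ C) :
    ({D | G.IsCompOf Z D ∧ Odd D.ncard} \ {C}).ncard + G.oddCompCount (C \ Y) ≤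
      G.oddCompCount (Z \ Y) := by
  rw [oddCompCount, oddCompCount, ← ncard_union_eq _ (toFinite _) (toFinite _)]
  · refine ncard_le_ncard ?_ (toFinite _)
    rintro D (⟨⟨hD, hodd⟩, hDC⟩ | ⟨hD, hodd⟩)
    · have hdis := hD.disjoint hC hDC
      refine ⟨⟨fun x hx => ⟨hD.subset hx, fun hxY => Set.disjoint_left.1 hdis hx (hY hxY)⟩,
        hD.connected, fun u hu v hv => hD.closed u hu v hv.1⟩, hodd⟩
    · refine ⟨⟨fun x hx => ⟨hC.subset (hD.subset hx).1, (hD.subset hx).2⟩, hD.connected,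
        fun u hu v hv huv => ?_⟩, hodd⟩
      exact hD.closed u hu v ⟨hC.closed u (hD.subset hu).1 v hv.1 huv, hv.2⟩ huv
  · rw [Set.disjoint_left]
    rintro D ⟨⟨hD, -⟩, hDC⟩ ⟨hD', -⟩
    obtain ⟨x, hx⟩ := hD.nonempty
    exact hDC (hD.eq_of_inter hC ⟨x, hx, (hD'.subset hx).1⟩)

/-- `G` has a matching with vertex set `S`, given by the map to the partner. -/
def HasMatching (G : SimpleGraph V) (S : Set V) : Prop :=
  ∃ m : V → V, ∀ x ∈ S, m x ∈ S ∧ G.Adj x (m x) ∧ m (m x) = x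

theorem HasMatching.tiled [Finite V] {S : Set V} {m : V → V}
    (hm : ∀ x ∈ S, m x ∈ S ∧ G.Adj x (m x) ∧ m (m x) = x) : Tiled G.IsP2P5Set S := by
  induction hn : S.ncard using Nat.strong_induction_on generalizing S with
  | _ n ih =>
  rcases S.eq_empty_or_nonempty with rfl | ⟨x, hx⟩
  · exact .empty
  have hsub : ({x, m x} : Set V) ⊆ S := insert_subset hx (singleton_subset_iff.2 (hm x hx).1)
  have h1 : Tiled G.IsP2P5Set (S \ {x, m x}) := by
    refine ih _ ?_ (fun y hy => ?_) rfl
    · rw [← hn]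
      exact ncard_lt_ncard ⟨sdiff_subset, fun h => (h hx).2 (by simp)⟩ (toFinite _)
    · obtain ⟨h1, h2, h3⟩ := hm y hy.1
      refine ⟨⟨h1, fun hmem => hy.2 ?_⟩, h2, h3⟩
      rcases hmem with h | h
      · exact .inr (by rw [← h, h3]; rfl)
      · exact .inl (by rw [← h3, h, (hm x hx).2.2])
  have h2 := Tiled.union (.inl (isPathSet_two (hm x hx).2.1)) h1 disjoint_sdiff_right
  rwa [union_sdiff_cancel hsub] at h2

/-- Tutte's theorem for an induced subgraph. -/
theorem hasMatching_of_oddCompCount_le [Finite V] (W : Set V)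
    (h : ∀ U ⊆ W, G.oddCompCount (W \ U) ≤ U.ncard) : G.HasMatching W := by
  classical
  have : ∃ M : Subgraph (G.induce W), M.IsPerfectMatching := by
    rw [tutte]
    intro u hu
    let K := ((⊤ : (G.induce W).Subgraph).deleteVerts u)
    let f : K.coe ↪g G :=
      { toFun := fun x => x.1.1
        inj' := fun x y hxy => Subtype.ext (Subtype.ext hxy)
        map_rel_iff' := by
          intro x y
          have hx := x.2
          have hy := y.2
          simp only [K, Subgraph.deleteVerts_verts, Subgraph.verts_top, mem_sdiff, mem_univ,
            true_and] at hx hy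
          simp only [K, hx, hy, Subgraph.coe_adj, Subgraph.deleteVerts_adj, Subgraph.verts_top,
            mem_univ, not_false_eq_true, true_and, Subgraph.top_adj, comap_adj]
          exact Iff.rfl }
    have hr : range f = W \ (Subtype.val '' u) := by
      ext x
      constructor
      · rintro ⟨y, rfl⟩
        refine ⟨y.1.2, ?_⟩
        rintro ⟨z, hz, hzy⟩
        have hy := y.2.2
        rw [← Subtype.ext hzy] at hy
        exact hy hz
      · rintro ⟨hx, hxu⟩
        exact ⟨⟨⟨x, hx⟩, ⟨trivial, fun h => hxu ⟨_, h, rfl⟩⟩⟩, rfl⟩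
    have h1 := h (Subtype.val '' u) (by rintro _ ⟨x, -, rfl⟩; exact x.2)
    rw [oddCompCount, ← hr, ← ncard_components_eq f,
      ncard_image_of_injective _ Subtype.val_injective] at h1
    exact hu.not_ge h1
  obtain ⟨M, hM⟩ := this
  rw [Subgraph.isPerfectMatching_iff] at hM
  choose m hm hm' using hM
  refine ⟨fun x => if hx : x ∈ W then m ⟨x, hx⟩ else x, fun x hx => ?_⟩
  simp only [dif_pos hx, Subtype.coe_prop, dite_true, Subtype.coe_eta, true_and]
  refine ⟨(hm ⟨x, hx⟩).adj_sub, ?_⟩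
  exact congrArg Subtype.val (hm' _ _ (hm ⟨x, hx⟩).symm).symm

/-! ### Factor-critical graphs -/

/-- The graph induced by `C` is connected, and deleting any vertex leaves a graph with a perfect
matching. -/
def FactorCritical (G : SimpleGraph V) (C : Set V) : Prop :=
  (G.induce C).Connected ∧ ∀ v ∈ C, G.HasMatching (C \ {v})

/-- Delete some other vertex and let `p` be the partner of `v`; after deleting `p` instead, `v` has
a new partner. -/
theorem FactorCritical.exists_two_adj [Finite V] {C : Set V} (hC : G.FactorCritical C)
    (hcard : 1 < C.ncard) {v : V} (hv : v ∈ C) :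
    ∃ p ∈ C, ∃ q ∈ C, p ≠ q ∧ G.Adj v p ∧ G.Adj v q := by
  obtain ⟨x, hx, hxv⟩ := exists_ne_of_one_lt_ncard hcard v
  obtain ⟨m, hm⟩ := hC.2 x hx
  obtain ⟨h1, h2, -⟩ := hm v ⟨hv, hxv.symm⟩
  obtain ⟨m', hm'⟩ := hC.2 (m v) h1.1
  obtain ⟨h3, h4, -⟩ := hm' v ⟨hv, h2.ne⟩
  exact ⟨m v, h1.1, m' v, h3.1, fun h => h3.2 h.symm, h2, h4⟩

/-- Here `P` without `v` is a union of matching edges, so `m` restricts to a matching of the rest.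
-/
theorem tiled_of_path_of_matching [Finite V] {C P : Set V} {m : V → V} {v : V}
    (hm : ∀ x ∈ C \ {v}, m x ∈ C \ {v} ∧ G.Adj x (m x) ∧ m (m x) = x) (hP : G.IsPathSet 5 P)
    (hPC : P ⊆ C) (hv : v ∈ P) (hmP : ∀ x ∈ C \ {v}, m x ∈ P → x ∈ P) :
    Tiled G.IsP2P5Set C := by
  have h1 : Tiled G.IsP2P5Set (C \ P) := by
    refine HasMatching.tiled (m := m) fun x hx => ?_
    have hx' : x ∈ C \ {v} := ⟨hx.1, by rintro rfl; exact hx.2 hv⟩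
    obtain ⟨h1, h2, h3⟩ := hm x hx'
    exact ⟨⟨h1.1, fun h => hx.2 (hmP x hx' h)⟩, h2, h3⟩
  have h2 := Tiled.union (.inr hP) h1 disjoint_sdiff_right
  rwa [union_sdiff_cancel hPC] at h2

/-- Match `C \ {v}` by `m`. Neighbours `p`, `q` of `v` in different matching edges give the path `m
p, p, v, q, m q` (`center`). Otherwise `v` forms a triangle with a matching edge `{a, b}`, and a
neighbour `x` of `a` outside it gives `v, b, a, x, m x` (`side`). If neither occurs, the triangle is
closed under adjacency in the connected set `C`, contradicting its size. -/
theorem FactorCritical.tiled [Finite V] {C : Set V} (hC : G.FactorCritical C)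
    (hcard : 3 < C.ncard) : Tiled G.IsP2P5Set C := by
  obtain ⟨v, hv⟩ : C.Nonempty := nonempty_coe_sort.1 hC.1.nonempty
  obtain ⟨m, hm⟩ := hC.2 v hv
  have center : ∀ p ∈ C, ∀ q ∈ C, G.Adj v p → G.Adj v q → p ≠ q → q ≠ m p →
      Tiled G.IsP2P5Set C := by
    intro p hp q hq hvp hvq hpq hqp
    obtain ⟨p1, p2, p3⟩ := hm p ⟨hp, hvp.ne'⟩
    obtain ⟨q1, q2, q3⟩ := hm q ⟨hq, hvq.ne'⟩
    have hmm : m p ≠ m q := fun h => hpq (by rw [← p3, h, q3])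
    have hpmq : p ≠ m q := fun h => hqp (by rw [h, q3])
    refine tiled_of_path_of_matching hm
      (isPathSet_five p2.symm hvp.symm hvq q2 p1.2 hqp.symm hmm hpq hpmq
        (fun h => q1.2 h.symm)) ?_ (by simp) ?_
    · rintro x (rfl | rfl | rfl | rfl | rfl)
      exacts [p1.1, hp, hv, hq, q1.1]
    · intro x hx hmx
      obtain ⟨x1, x2, x3⟩ := hm x hx
      simp only [mem_insert_iff, mem_singleton_iff] at hmx ⊢
      rcases hmx with h | h | h | h | h
      · exact .inr (.inl (by rw [← x3, h, p3]))
      · exact .inl (by rw [← x3, h])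
      · exact (x1.2 h).elim
      · exact .inr (.inr (.inr (.inr (by rw [← x3, h]))))
      · exact .inr (.inr (.inr (.inl (by rw [← x3, h, q3]))))
  obtain ⟨p, hp, q, hq, hpq, hvp, hvq⟩ := hC.exists_two_adj (by lia) hv
  by_cases hqp : q = m p
  swap
  · exact center p hp q hq hvp hvq hpq hqp
  subst hqp
  obtain ⟨p1, p2, p3⟩ := hm p ⟨hp, hvp.ne'⟩
  have side : ∀ a b, a ∈ C → b ∈ C → G.Adj v b → v ≠ a → m a = b → m b = a → G.Adj b a →
      (∀ x ∈ C, G.Adj a x → x ≠ v → x ≠ b → Tiled G.IsP2P5Set C) := by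
    intro a b ha hb hvb hva hab hba hadj x hx hax hxv hxb
    obtain ⟨x1, x2, x3⟩ := hm x ⟨hx, hxv⟩
    refine tiled_of_path_of_matching hm
      (isPathSet_five hvb hadj hax x2 hva hxv.symm (fun h => x1.2 h.symm) hxb.symm
        (fun h => hax.ne (by rw [← hba, h, x3])) (fun h => hxb (by rw [← hab, h, x3])))
        ?_ (by simp) ?_
    · rintro y (rfl | rfl | rfl | rfl | rfl)
      exacts [hv, hb, ha, hx, x1.1]
    · intro y hy hmy
      obtain ⟨y1, y2, y3⟩ := hm y hy
      simp only [mem_insert_iff, mem_singleton_iff] at hmy ⊢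
      rcases hmy with h | h | h | h | h
      · exact (y1.2 h).elim
      · exact .inr (.inr (.inl (by rw [← y3, h, hba])))
      · exact .inr (.inl (by rw [← y3, h, hab]))
      · exact .inr (.inr (.inr (.inr (by rw [← y3, h]))))
      · exact .inr (.inr (.inr (.inl (by rw [← y3, h, x3]))))
  by_contra hcon
  have hsub : C ⊆ {v, p, m p} := by
    refine hC.1.subset_of_closed ⟨v, hv, by simp⟩ fun u hu x hx hux => ?_
    by_contra hx'
    simp only [mem_insert_iff, mem_singleton_iff, not_or] at hx'
    rcases hu with rfl | rfl | rfl
    · exact hcon (center p hp x hx hvp hux (Ne.symm hx'.2.1) hx'.2.2)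
    · exact hcon (side u (m u) hp hq hvq hvp.ne rfl p3 p2.symm x hx hux hx'.1 hx'.2.2)
    · exact hcon (side (m p) p hq hp hvp hvq.ne p3 rfl p2 x hx hux hx'.1 hx'.2.1)
  have h1 := ncard_le_ncard hsub (toFinite _)
  have h2 := ncard_insert_le v {p, m p}
  have h3 := ncard_insert_le p {m p}
  rw [ncard_singleton] at h3
  lia

end SimpleGraph

/-! ### The extremal barrier -/

namespace SimpleGraph

variable {V : Type*} {G : SimpleGraph V}

/-- There is a set `Z` maximizing the number of odd components plus the number of vertices and,
among those, having the least number of vertices. -/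
theorem exists_extremal [Finite V] (G : SimpleGraph V) : ∃ Z : Set V, ∀ Z' : Set V,
    G.oddCompCount Z' + Z'.ncard ≤ G.oddCompCount Z + Z.ncard ∧
      (Z'.ncard < Z.ncard → G.oddCompCount Z' + Z'.ncard < G.oddCompCount Z + Z.ncard) := by
  -- The factor exceeds every possible value of `Zᶜ.ncard`, so one number encodes the lexicographic
  -- order.
  obtain ⟨Z, -, hZ⟩ := (toFinite (univ : Set (Set V))).exists_maximalFor
    (fun Z => (Nat.card V + 1) * (G.oddCompCount Z + Z.ncard) + Zᶜ.ncard) _ univ_nonempty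
  have hZ' : ∀ Z' : Set V, (Nat.card V + 1) * (G.oddCompCount Z' + Z'.ncard) + Z'ᶜ.ncard ≤
      (Nat.card V + 1) * (G.oddCompCount Z + Z.ncard) + Zᶜ.ncard := fun Z' =>
    (le_total _ _).elim id fun h => hZ (mem_univ Z') h
  refine ⟨Z, fun Z' => ?_⟩
  have h1 := hZ' Z'
  have h2 := ncard_add_ncard_compl Z
  have h3 := ncard_add_ncard_compl Z'
  have hle : G.oddCompCount Z' + Z'.ncard ≤ G.oddCompCount Z + Z.ncard := by
    by_contra hlt
    have h4 := Nat.mul_le_mul_left (Nat.card V + 1) (Nat.succ_le_of_lt (not_le.1 hlt))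
    rw [Nat.succ_eq_add_one, mul_add, mul_one] at h4
    lia
  refine ⟨hle, fun hlt => lt_of_le_of_ne hle fun heq => ?_⟩
  rw [heq] at h1
  lia

/-- Compare `Z` with `Z \ Y` for nonempty `Y ⊆ C`. If `C` were even, removing one vertex would
create an odd component at no loss. If `C` is odd, take `Y = insert v U`: extremality bounds the odd
components of `C \ Y` by `|U| + 1`, parity improves this to `|U|`, and Tutte's theorem matches `C \
{v}`. -/
theorem factorCritical_of_extremal [Finite V] {Z C : Set V}
    (hZ : ∀ Z' : Set V, Z'.ncard < Z.ncard →
      G.oddCompCount Z' + Z'.ncard < G.oddCompCount Z + Z.ncard)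
    (hC : G.IsCompOf Z C) : Odd C.ncard ∧ G.FactorCritical C := by
  have hY : ∀ Y ⊆ C, Y.Nonempty →
      ({D | G.IsCompOf Z D ∧ Odd D.ncard} \ {C}).ncard + G.oddCompCount (C \ Y) <
        G.oddCompCount Z + Y.ncard := by
    intro Y hYC hne
    have h1 := oddCompCount_add_le hC hYC
    have hYZ := hYC.trans hC.subset
    have h2 := ncard_sdiff_add_ncard_of_subset hYZ
    have h3 := (ncard_pos (toFinite Y)).2 hne
    have h4 := hZ (Z \ Y) (by lia)
    lia
  have hodd : Odd C.ncard := by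
    by_contra heven
    obtain ⟨v, hv⟩ := hC.nonempty
    have h1 := hY {v} (singleton_subset_iff.2 hv) (singleton_nonempty v)
    rw [sdiff_singleton_eq_self (fun h => heven h.2), ncard_singleton] at h1
    have h2 : Odd (G.oddCompCount (C \ {v})) := by
      rw [odd_oddCompCount]
      have h3 := ncard_sdiff_singleton_add_one hv
      rw [← h3, Nat.not_odd_iff_even] at heven
      by_contra h4
      exact (Nat.not_even_iff_odd.2 (Nat.not_odd_iff_even.1 h4).add_one) heven
    have h3 := h2.pos
    change G.oddCompCount Z + _ < _ at h1
    lia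
  refine ⟨hodd, hC.connected, fun v hv => ?_⟩
  refine hasMatching_of_oddCompCount_le _ fun U hU => ?_
  have hvU : v ∉ U := fun h => (hU h).2 rfl
  have hins : insert v U ⊆ C := insert_subset hv (hU.trans sdiff_subset)
  have h1 := hY (insert v U) hins (insert_nonempty v U)
  have h2 : ({D | G.IsCompOf Z D ∧ Odd D.ncard} \ {C}).ncard + 1 = G.oddCompCount Z :=
    ncard_sdiff_singleton_add_one (show C ∈ {D | G.IsCompOf Z D ∧ Odd D.ncard} from ⟨hC, hodd⟩)
  rw [ncard_insert_of_notMem hvU] at h1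
  have hset : (C \ {v}) \ U = C \ insert v U := by
    rw [sdiff_sdiff, singleton_union]
  rw [hset]
  have h3 := ncard_sdiff_add_ncard_of_subset hins
  rw [ncard_insert_of_notMem hvU] at h3
  have h4 := odd_oddCompCount (G := G) (C \ insert v U)
  by_contra hlt
  have h5 : G.oddCompCount (C \ insert v U) = U.ncard + 1 := by lia
  rw [h5] at h4
  simp only [Nat.odd_iff] at h4 hodd
  lia

/-- Moving `s ⊆ Zᶜ` into `Z` gains `|s|` vertices and keeps every odd component not adjacent to `s`.
By maximality at least `|s|` components are adjacent to `s`, which is Hall's condition. -/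
theorem exists_injective_of_extremal [Finite V] {Z : Set V}
    (hZ : ∀ Z' : Set V, G.oddCompCount Z' + Z'.ncard ≤ G.oddCompCount Z + Z.ncard) :
    ∃ M : ↥Zᶜ → {C // G.IsCompOf Z C}, Function.Injective M ∧
      ∀ a, ∃ x ∈ (M a).1, G.Adj a x := by
  classical
  have := Fintype.ofFinite {C // G.IsCompOf Z C}
  let t : ↥Zᶜ → Finset {C // G.IsCompOf Z C} := fun a =>
    Finset.univ.filter fun C => ∃ x ∈ C.1, G.Adj a x
  obtain ⟨M, hM, hMt⟩ := (Finset.all_card_le_biUnion_card_iff_exists_injective t).1 (by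
    intro s
    have h1 := hZ (Z ∪ Subtype.val '' (s : Set ↥Zᶜ))
    have hdis : Disjoint Z (Subtype.val '' (s : Set ↥Zᶜ)) := by
      rw [Set.disjoint_right]
      rintro _ ⟨x, -, rfl⟩
      exact x.2
    rw [ncard_union_eq hdis (toFinite _) (toFinite _),
      ncard_image_of_injective _ Subtype.val_injective, ncard_coe_finset] at h1
    have h2 : {D | G.IsCompOf Z D ∧ Odd D.ncard} ⊆
        {D | G.IsCompOf (Z ∪ Subtype.val '' (s : Set ↥Zᶜ)) D ∧ Odd D.ncard} ∪
          Subtype.val '' ((s.biUnion t : Finset {C // G.IsCompOf Z C}) :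
            Set {C // G.IsCompOf Z C}) := by
      rintro D ⟨hD, hDodd⟩
      by_cases h : ∃ a ∈ s, ∃ x ∈ D, G.Adj (a : V) x
      · obtain ⟨a, ha, hx⟩ := h
        right
        refine ⟨⟨D, hD⟩, ?_, rfl⟩
        simp only [Finset.coe_biUnion, mem_iUnion]
        exact ⟨a, ha, Finset.mem_coe.2 (Finset.mem_filter.2 ⟨Finset.mem_univ _, hx⟩)⟩
      · left
        refine ⟨⟨hD.subset.trans subset_union_left, hD.connected, ?_⟩, hDodd⟩
        rintro u hu v (hv | ⟨a, ha, rfl⟩) huv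
        · exact hD.closed u hu v hv huv
        · exact (h ⟨a, ha, u, hu, huv.symm⟩).elim
    have h3 := (ncard_le_ncard h2 (toFinite _)).trans (ncard_union_le _ _)
    rw [ncard_image_of_injective _ Subtype.val_injective, ncard_coe_finset] at h3
    change G.oddCompCount Z ≤ G.oddCompCount _ + _ at h3
    lia)
  exact ⟨M, hM, fun a => (Finset.mem_filter.1 (hMt a)).2⟩

/-! ### From the contracted graph back to `G` -/

/-- The demand of a component of order `n`: `3` for an isolated vertex, `2` for a triangle. -/
def orderDemand (n : ℕ) : ℕ := if n = 1 then 3 else if n = 3 then 2 else 0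

/-- All neighbours in `Zᶜ` of the components in `Y` lie in `X`, so these components survive in `G -
X`; then apply three times the hypothesis. -/
theorem sum_orderDemand_le [Finite V] {Z : Set V}
    (h : ∀ X : Set V,
      ((G.induce Xᶜ).numComponentsOfOrder 1 : ℝ)
          + 2 / 3 * ((G.induce Xᶜ).numComponentsOfOrder 3 : ℝ)
        ≤ 4 / 3 * (X.ncard : ℝ) + 1 / 3)
    (X : Finset ↥Zᶜ) (Y : Finset {C // G.IsCompOf Z C})
    (hXY : ∀ a : ↥Zᶜ, ∀ C ∈ Y, (∃ x ∈ C.1, G.Adj a x) → a ∈ X) :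
    ∑ C ∈ Y, orderDemand C.1.ncard ≤ 4 * X.card + 1 := by
  classical
  have hcount : ∀ i, (Y.filter fun C => C.1.ncard = i).card ≤
      (G.induce (Subtype.val '' (X : Set ↥Zᶜ))ᶜ).numComponentsOfOrder i := by
    intro i
    rw [numComponentsOfOrder, ncard_induce_components_eq (P := fun n => n = i),
      ← ncard_coe_finset, ← ncard_image_of_injective _ Subtype.val_injective]
    refine ncard_le_ncard ?_ (toFinite _)
    rintro _ ⟨C, hC, rfl⟩
    obtain ⟨hCY, hCi⟩ := Finset.mem_filter.1 (Finset.mem_coe.1 hC)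
    refine ⟨⟨?_, C.2.connected, ?_⟩, hCi⟩
    · rintro x hx ⟨a, -, rfl⟩
      exact a.2 (C.2.subset hx)
    · intro u hu v hv huv
      by_cases hvZ : v ∈ Z
      · exact C.2.closed u hu v hvZ huv
      · exact (hv ⟨⟨v, hvZ⟩, hXY ⟨v, hvZ⟩ C hCY ⟨u, hu, huv.symm⟩, rfl⟩).elim
  have hsum : ∑ C ∈ Y, orderDemand C.1.ncard =
      3 * (Y.filter fun C => C.1.ncard = 1).card + 2 * (Y.filter fun C => C.1.ncard = 3).card := by
    rw [Finset.card_filter, Finset.card_filter, Finset.mul_sum, Finset.mul_sum,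
      ← Finset.sum_add_distrib]
    refine Finset.sum_congr rfl fun C _ => ?_
    rw [orderDemand]
    split_ifs <;> lia
  have h1 := h (Subtype.val '' (X : Set ↥Zᶜ))
  rw [ncard_image_of_injective _ Subtype.val_injective, ncard_coe_finset] at h1
  have h2 : 3 * (G.induce (Subtype.val '' (X : Set ↥Zᶜ))ᶜ).numComponentsOfOrder 1 +
      2 * (G.induce (Subtype.val '' (X : Set ↥Zᶜ))ᶜ).numComponentsOfOrder 3 ≤ 4 * X.card + 1 := by
    have : (3 * (G.induce (Subtype.val '' (X : Set ↥Zᶜ))ᶜ).numComponentsOfOrder 1 +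
      2 * (G.induce (Subtype.val '' (X : Set ↥Zᶜ))ᶜ).numComponentsOfOrder 3 : ℝ) ≤
        4 * X.card + 1 := by linarith
    exact_mod_cast this
  have h3 := hcount 1
  have h4 := hcount 3
  lia

/-- A component entered at one vertex leaves a perfectly matched rest. A `single` has odd order at
least five and is tiled alone. In a `cherry` the P₅ runs through all of the triangle, then `a`, then
one vertex of the other component; in a `path` the middle component is one vertex. -/
theorem tiled_of_barrierPiece [Finite V] {Z : Set V}
    (hcrit : ∀ C, G.IsCompOf Z C → Odd C.ncard ∧ G.FactorCritical C)
    {P : Set (↥Zᶜ ⊕ {C // G.IsCompOf Z C})}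
    (hP : BarrierPiece (fun (a : ↥Zᶜ) (C : {C // G.IsCompOf Z C}) => ∃ x ∈ C.1, G.Adj (a : V) x)
      (fun C => orderDemand C.1.ncard) P) :
    Tiled G.IsP2P5Set (⋃ x ∈ P, Sum.elim (fun a : ↥Zᶜ => {(a : V)})
      (fun C : {C // G.IsCompOf Z C} => C.1) x) := by
  have haC : ∀ (a : ↥Zᶜ) (C : {C // G.IsCompOf Z C}), (a : V) ∉ C.1 := fun a C h =>
    a.2 (C.2.subset h)
  have hrest : ∀ (C : {C // G.IsCompOf Z C}), ∀ x ∈ C.1, Tiled G.IsP2P5Set (C.1 \ {x}) := by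
    intro C x hx
    obtain ⟨m, hm⟩ := (hcrit C.1 C.2).2.2 x hx
    exact HasMatching.tiled hm
  have hne : ∀ (C D : {C // G.IsCompOf Z C}), C ≠ D → Disjoint C.1 D.1 := fun C D h =>
    C.2.disjoint D.2 fun h' => h (Subtype.ext h')
  cases hP with
  | @single C h =>
    simp only [mem_singleton_iff, iUnion_iUnion_eq_left, Sum.elim_inr]
    refine (hcrit C.1 C.2).2.tiled ?_
    have hodd := Nat.odd_iff.1 (hcrit C.1 C.2).1
    simp only [orderDemand] at h
    split_ifs at h
    lia
  | @edge a C h =>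
    obtain ⟨x, hx, hax⟩ := h
    simp only [biUnion_insert, biUnion_singleton, Sum.elim_inl, Sum.elim_inr]
    refine Tiled.of_union_eq (.of_piece (.inl (isPathSet_two hax))) (hrest C x hx) ?_ ?_
    · have := haC a C
      simp [this]
    · ext y
      simp only [mem_union, mem_insert_iff, mem_singleton_iff, mem_sdiff]
      grind
  | @cherry a C D hdem hC hD hCD =>
    obtain ⟨x, hx, hax⟩ := hC
    obtain ⟨y, hy, hay⟩ := hD
    have hC3 : C.1.ncard = 3 := by
      simp only [orderDemand] at hdem
      split_ifs at hdem <;> lia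
    obtain ⟨p, hp, q, hq, hpq, hxp, hxq⟩ := (hcrit C.1 C.2).2.exists_two_adj (by lia) hx
    have hCeq : C.1 = {x, p, q} := by
      refine (eq_of_subset_of_ncard_le ?_ ?_ (toFinite _)).symm
      · rintro z (rfl | rfl | rfl) <;> assumption
      · rw [hC3, ncard_eq_three.2 ⟨x, p, q, hxp.ne, hxq.ne, hpq, rfl⟩]
    obtain ⟨m, hm⟩ := (hcrit C.1 C.2).2.2 x hx
    -- The matching of `C \ {x}` has to pair `p` with `q`.
    have hpq' : G.Adj q p := by
      obtain ⟨h1, h2, -⟩ := hm p ⟨hp, hxp.ne'⟩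
      have h3 := h1.1
      rw [hCeq] at h3
      rcases h3 with h3 | h3 | h3
      · exact (h1.2 h3).elim
      · exact (h2.ne h3.symm).elim
      · rw [h3] at h2; exact h2.symm
    have ha := haC a
    have hyC : ∀ z ∈ C.1, z ≠ y := fun z hz h =>
      Set.disjoint_left.1 (hne C D hCD) hz (h ▸ hy)
    have haz : ∀ z ∈ C.1, z ≠ a := fun z hz h => ha C (h ▸ hz)
    simp only [biUnion_insert, biUnion_singleton, Sum.elim_inl, Sum.elim_inr]
    refine Tiled.of_union_eq (.of_piece (.inr (isPathSet_five hpq' hxp.symm hax.symm hay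
      hxq.ne' (haz q hq) (hyC q hq) (haz p hp) (hyC p hp) (hyC x hx)))) (hrest D y hy) ?_ ?_
    · have hdis := hne C D hCD
      rw [hCeq] at hdis
      simp only [disjoint_insert_left, disjoint_singleton_left, mem_sdiff, mem_singleton_iff]
        at hdis ⊢
      have := ha D
      tauto
    · rw [hCeq]
      ext z
      simp only [mem_union, mem_insert_iff, mem_singleton_iff, mem_sdiff]
      grind
  | @path a b C D E hdem hC hD hD' hE hab hCD hCE hDE =>
    obtain ⟨x, hx, hax⟩ := hC
    obtain ⟨y, hy, hay⟩ := hD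
    obtain ⟨y', hy', hby⟩ := hD'
    obtain ⟨z, hz, hbz⟩ := hE
    have hD1 : D.1.ncard = 1 := by
      simp only [orderDemand] at hdem
      split_ifs at hdem <;> lia
    obtain ⟨w, hw⟩ := ncard_eq_one.1 hD1
    rw [hw, mem_singleton_iff] at hy hy'
    subst hy hy'
    have hab' : (a : V) ≠ b := fun h => hab (Subtype.ext h)
    have dCD := hne C D hCD
    have dCE := hne C E hCE
    have dDE := hne D E hDE
    have hyD : y' ∈ D.1 := by rw [hw]; rfl
    have ne : ∀ (a : ↥Zᶜ) (C : {C // G.IsCompOf Z C}), ∀ x ∈ C.1, x ≠ a := fun a C x hx h =>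
      haC a C (h ▸ hx)
    simp only [biUnion_insert, biUnion_singleton, Sum.elim_inl, Sum.elim_inr]
    refine Tiled.of_union_eq (.of_piece (.inr (isPathSet_five hax.symm hay hby.symm hbz
      (fun h => Set.disjoint_left.1 dCD hx (h ▸ hyD)) (ne b C x hx)
      (fun h => Set.disjoint_left.1 dCE hx (h ▸ hz)) hab' (ne a E z hz).symm
      (fun h => Set.disjoint_left.1 dDE hyD (h ▸ hz)))))
      ((hrest C x hx).disjUnion (hrest E z hz) (dCE.mono sdiff_subset sdiff_subset)) ?_ ?_
    · have h1 := haC a C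
      have h2 := haC a E
      have h3 := haC b C
      have h4 := haC b E
      have h5 := Set.disjoint_left.1 dCE hx
      have h6 := Set.disjoint_right.1 dCE hz
      have h7 := Set.disjoint_right.1 dCD hyD
      have h8 := Set.disjoint_left.1 dDE hyD
      simp only [disjoint_insert_left, disjoint_singleton_left, mem_sdiff, mem_singleton_iff,
        mem_union]
      tauto
    · rw [hw]
      ext u
      simp only [mem_union, mem_insert_iff, mem_singleton_iff, mem_sdiff]
      grind

end SimpleGraph

/-! ### Assembling the factor -/

theorem mainTheorem1 {V : Type*} [Finite V] (G : SimpleGraph V)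
    (h : ∀ X : Set V,
      ((G.induce Xᶜ).numComponentsOfOrder 1 : ℝ)
          + 2 / 3 * ((G.induce Xᶜ).numComponentsOfOrder 3 : ℝ)
        ≤ 4 / 3 * (X.ncard : ℝ) + 1 / 3) :
    ∃ F : SimpleGraph V, G.IsP2P5Factor F := by
  classical
  obtain ⟨Z, hZ⟩ := G.exists_extremal
  have hcrit : ∀ C, G.IsCompOf Z C → Odd C.ncard ∧ G.FactorCritical C := fun C hC =>
    SimpleGraph.factorCritical_of_extremal (fun Z' => (hZ Z').2) hC
  obtain ⟨M, hM, hMr⟩ := SimpleGraph.exists_injective_of_extremal fun Z' => (hZ Z').1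
  have := Fintype.ofFinite ↥Zᶜ
  have := Fintype.ofFinite {C // G.IsCompOf Z C}
  have hweak := tiled_weakBarrierPiece
    (r := fun (a : ↥Zᶜ) (C : {C // G.IsCompOf Z C}) => ∃ x ∈ C.1, G.Adj (a : V) x)
    (dem := fun C => SimpleGraph.orderDemand C.1.ncard)
    (fun C => by simp only [SimpleGraph.orderDemand]; split_ifs <;> simp)
    (SimpleGraph.sum_orderDemand_le h)
  have htiled := (hweak.barrierPiece_of_weak hM hMr).blowup
    (φ := Sum.elim (fun a : ↥Zᶜ => {(a : V)}) (fun C : {C // G.IsCompOf Z C} => C.1)) (by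
      rintro (a | C) (b | D) hne
      · simpa [Function.onFun, Subtype.ext_iff, eq_comm] using hne
      · simpa [Function.onFun] using fun h => a.2 (D.2.subset h)
      · simpa [Function.onFun] using fun h => b.2 (C.2.subset h)
      · exact C.2.disjoint D.2 fun h => hne (congrArg Sum.inr (Subtype.ext h)))
    (fun P hP => SimpleGraph.tiled_of_barrierPiece hcrit hP)
  refine SimpleGraph.exists_isP2P5Factor_of_tiled (htiled.congr (eq_univ_of_forall fun v => ?_))
  by_cases hv : v ∈ Z
  · obtain ⟨C, hC, hvC⟩ : ∃ C, G.IsCompOf Z C ∧ v ∈ C := by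
      have hr : range (SimpleGraph.Embedding.induce (G := G) Z) = Z := Subtype.range_coe
      have := SimpleGraph.isCompOf_image_supp (SimpleGraph.Embedding.induce (G := G) Z)
        ((G.induce Z).connectedComponentMk ⟨v, hv⟩)
      rw [hr] at this
      exact ⟨_, this, ⟨v, hv⟩, rfl, rfl⟩
    exact mem_iUnion₂.2 ⟨.inr ⟨C, hC⟩, mem_univ _, hvC⟩
  · exact mem_iUnion₂.2 ⟨.inl ⟨v, hv⟩, mem_univ _, rfl⟩
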